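/- **Conventions.** A \emph{ptableau} is a rectangular array whose boxes are blank or contain positive integers (a non-blank box is a \emph{cell}), such that (i) for each $i$ the cells with content $i$ form a horizontal strip: no two lie in the same column, and if one lies in a column to the left of another then its row is weakly lower; (ii) if $i<j$, no $j$ lies weakly above and weakly to the left of an $i$; (iii) the number of columns is minimal among arrays satisfying (i), (ii) and having the same content in each row. Ptableaux are considered up to row-equivalence (same content in each row), so a ptableau $T$ is given by its multiset of cells $[a]_r$ (content $a$ in row $r$). Its left-justified form ${}^*T$ (right-justified form $T^*$) is the array in the class of $T$ in which every cell is weakly left (right) of the corresponding cell in every other array of the class. The \emph{dual} $\widehat T$ has a cell $[r]_a$ for each cell $[a]_r$ of $T$. $T$ satisfies the \emph{word condition} if every content $i$ occurs only in rows $\ge i$ and, for all $i\ge 1$ and $k\ge 0$, the number of $i$'s in rows $i,\dots,i+k$ is at least the number of $(i+1)$'s in rows $i+1,\dots,i+k+1$. $\mathrm{Bw}(T)$ is the list of all pairs (content, row) of $T$, ordered so that contents weakly increase and, for equal contents, rows weakly decrease. $T\otimes[s]_k$ denotes $T$ with a cell $[s]_k$ added, where it is required that $\mathrm{Bw}(T\otimes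 [s]_k)$ is $\mathrm{Bw}(T)$ followed by $(s,k)$; that is, every content of $T$ is $\le s$ and every $s$ in $T$ lies in a row $\ge k$. A cell $[s]_k$ with $s\ge 2$ of $T^*$ is a \emph{violation entry} if there is no $s-1$ in its column of $T^*$. A \emph{swap} replaces the content $s$ of a right-most violation entry by $s-1$. A \emph{resolution} of $T$ is obtained by performing successive swaps (right-justifying after each) until no violation entry is left. For $i\ge1$, $e_i(T)$ is defined as follows: if $[c]_{i+1}$ is the right-most entry of row $i+1$ with a blank above it in the left-justified form of the ptableau formed by rows $i,i+1$ of $T$, then $e_i(T)$ is $T$ with this cell $[c]_{i+1}$ replaced by $[c]_i$; if there is no such entry, $e_i(T)=\mathrm{NULL}$. $T$ is \emph{highest weight} if $e_i(T)=\mathrm{NULL}$ for all $i$. Column insertion of $x$ into a semistandard Young tableau (SSYT): in the first column $x$ replaces the smallest entry $\ge x$, which is then inserted in the same way into the next column, and so on; if a column has no such entry, the inserted number is put at its bottom and the process stops. **Lemma.** Suppose the ptableau $PT$ satisfies the word condition, and let $s,k\ge1$ be such that $PT\otimes[s]_k$ is defined. Then the (left-justified) dual $P=\widehat{PT}$ is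 an SSYT, $PT\otimes[s]_k$ has exactly one resolution $PT'$, and the (left-justified) dual $\widehat{PT'}$ is the SSYT obtained by column insertion of $k$ into $P$. Moreover, each swap of the resolution corresponds dually to applying a raising operator: if $T_1$ is obtained from $PT\otimes[s]_k$ by finitely many successive swaps and $T_2$ from $T_1$ by a further swap which changes a content $i+1$ to $i$, then $\widehat{T_2}=e_i(\widehat{T_1})$. The end result $\widehat{PT'}$ is highest weight. -/

import Mathlib

/-!
Perforated tableaux. Throughout, the letters of the alphabets, the rows and the columns are
numbered from `0` instead of from `1`: the letter (or row) `a` of the usual convention `1, 2, 3, …`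
is `a - 1` here, and the crystal operator `e_{i+1}` of that convention is `PTab.e i` here.
-/

/-- A ptableau up to row-equivalence, given by its content and the rows in which that content
appears: `(a, r)` is a cell with content `a` in row `r`, counted with multiplicity. The actual
rectangular arrays are the `Tableau`s related to it by `PTab.IsForm` below. -/
abbrev PTab : Type := Multiset (ℕ × ℕ)

/-- A rectangular array with `cols` columns (and as many rows as needed);
`entry r c` is the box in row `r` and column `c`, and `none` is a blank. -/
structure Tableau where
  cols : ℕ
  entry : ℕ → ℕ → Option ℕ
  entry_eq_none : ∀ r c, cols ≤ c → entry r c = none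

namespace PTab

/-- The array `F` has, in each row, exactly the content prescribed by `T`. -/
def HasCells (T : PTab) (F : Tableau) : Prop :=
  ∀ a r, T.count (a, r) = ((Finset.range F.cols).filter fun c => F.entry r c = some a).card

/-- The two conditions on the content of a ptableau: cells with equal content form a horizontal
strip, and no larger content lies weakly above and weakly to the left of a smaller one. -/
structure IsPerforated (F : Tableau) : Prop where
  strip_col : ∀ a r r' c, F.entry r c = some a → F.entry r' c = some a → r = r'
  strip_row : ∀ a r r' c c', F.entry r c = some a → F.entry r' c' = some a → c < c' → r' ≤ r
  order : ∀ a b r r' c c', F.entry r c = some a → F.entry r' c' = some b → a < b →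
    ¬ (r' ≤ r ∧ c' ≤ c)

/-- `F` is an actual ptableau (with the minimal number of columns) in the row-equivalence
class `T`. -/
def IsForm (T : PTab) (F : Tableau) : Prop :=
  T.HasCells F ∧ IsPerforated F ∧
    ∀ G : Tableau, T.HasCells G → IsPerforated G → F.cols ≤ G.cols

/-- The column of the `j`-th cell (from the left, starting with `j = 0`) of row `r`. -/
noncomputable def cellCol (F : Tableau) (r j : ℕ) : ℕ :=
  Nat.nth (fun c => F.entry r c ≠ none) j

/-- `F` is the left-justified form of `T`. -/
def IsLeftJustified (T : PTab) (F : Tableau) : Prop :=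
  T.IsForm F ∧ ∀ G : Tableau, T.IsForm G → ∀ r j, cellCol F r j ≤ cellCol G r j

/-- `F` is the right-justified form of `T`. -/
def IsRightJustified (T : PTab) (F : Tableau) : Prop :=
  T.IsForm F ∧ ∀ G : Tableau, T.IsForm G → ∀ r j, cellCol G r j ≤ cellCol F r j

/-- The dual: a cell with content `j` in row `i` for each cell with content `i` in row `j`. -/
def dual (T : PTab) : PTab := T.map Prod.swap

/-- The word condition: content `i` occurs only in rows `≥ i`, and the number of `i`'s in rows
`i, …, i + k` is at least the number of `(i+1)`'s in rows `i + 1, …, i + k + 1`. -/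
def WordCondition (T : PTab) : Prop :=
  (∀ x ∈ T, x.1 ≤ x.2) ∧
    ∀ i k : ℕ, T.countP (fun x => x.1 = i + 1 ∧ i + 1 ≤ x.2 ∧ x.2 ≤ i + k + 1) ≤
      T.countP (fun x => x.1 = i ∧ i ≤ x.2 ∧ x.2 ≤ i + k)

/-- A biword, as a list of its columns `(τ_j, ω_j)`, is in standard form. -/
def IsStandard (w : List (ℕ × ℕ)) : Prop :=
  w.Pairwise fun x y => x.1 < y.1 ∨ (x.1 = y.1 ∧ y.2 ≤ x.2)

/-- `w` is the biword of `T`: its columns are the pairs (content, row), in standard form. -/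
def IsBiword (T : PTab) (w : List (ℕ × ℕ)) : Prop := (w : Multiset (ℕ × ℕ)) = T ∧ IsStandard w

/-- `T` with a cell of content `s` appended to row `k`. -/
def adjoin (T : PTab) (s k : ℕ) : PTab := (s, k) ::ₘ T

/-- `T.adjoin s k` is an extension of `T`: its biword is the biword of `T` followed by the
column `(s, k)`. -/
def IsExtension (T : PTab) (s k : ℕ) : Prop :=
  ∃ w, T.IsBiword w ∧ (T.adjoin s k).IsBiword (w ++ [(s, k)])

/-! ### Crystal operators -/

/-- The ptableau `T[i, i+1]` formed by rows `i` and `i + 1` of `T`. -/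
def twoRows (T : PTab) (i : ℕ) : PTab := T.filter fun x => x.2 = i ∨ x.2 = i + 1

/-- In the left-justified form of `T[i, i+1]`, the right-most entry of row `i + 1` with a blank
above it has content `a`. -/
def IsRaised (T : PTab) (i a : ℕ) : Prop :=
  ∃ L, (T.twoRows i).IsLeftJustified L ∧ ∃ c, L.entry (i + 1) c = some a ∧ L.entry i c = none ∧
    ∀ c', c < c' → L.entry (i + 1) c' ≠ none → L.entry i c' ≠ none

open Classical in
/-- The raising operator, moving a cell from row `i + 1` to row `i`; `none` is `NULL`. -/
noncomputable def e (i : ℕ) (T : PTab) : Option PTab :=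
  if h : ∃ a, T.IsRaised i a then some ((h.choose, i) ::ₘ T.erase (h.choose, i + 1)) else none

/-- All raising operators give `NULL`. -/
def IsHighestWeight (T : PTab) : Prop := ∀ i, e i T = none

/-! ### Resolution -/

/-- The box in row `r` and column `c` of `F` is a violation entry with content `s + 1`: there is
no `s` in its column (a cell with the smallest possible content is never a violation entry). -/
def IsViolation (F : Tableau) (s r c : ℕ) : Prop :=
  F.entry r c = some (s + 1) ∧ ∀ r', F.entry r' c ≠ some s

/-- `T'` arises from `T` by a swap: the content `s + 1` of a right-most violation entry of the
right-justified form of `T` is replaced by `s`. -/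
def IsSwap (s : ℕ) (T T' : PTab) : Prop :=
  ∃ R, T.IsRightJustified R ∧ ∃ r c, IsViolation R s r c ∧
    (∀ s' r' c', IsViolation R s' r' c' → c' ≤ c) ∧ T' = (s, r) ::ₘ T.erase (s + 1, r)

/-- `T'` arises from `T` by finitely many successive swaps. -/
def Swaps : PTab → PTab → Prop := Relation.ReflTransGen fun T T' => ∃ s, IsSwap s T T'

/-- `T'` has no violation entries. -/
def NoViolation (T : PTab) : Prop :=
  ∃ R, T.IsRightJustified R ∧ ∀ s r c, ¬ IsViolation R s r c

/-- `T'` is a resolution of `T`: swaps are carried out until no violation entry is left. -/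
def IsResolution (T T' : PTab) : Prop := Swaps T T' ∧ NoViolation T'

end PTab

/-! ### Column insertion into semistandard Young tableaux -/

namespace ColumnInsertion

/-- Insert `x` into a strictly increasing column: `x` replaces the smallest entry `≥ x`, which is
bumped; if there is none, `x` is put at the bottom and nothing is bumped. -/
def intoColumn (x : ℕ) : List ℕ → List ℕ × Option ℕ
  | [] => ([x], none)
  | y :: ys => if x ≤ y then (x :: ys, some y)
      else (y :: (intoColumn x ys).1, (intoColumn x ys).2)

/-- Column insertion of `x` into a tableau given by the list of its columns, from left to right:
`x` goes into the first column, and bumped entries go into the next column. -/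
def insert (x : ℕ) : List (List ℕ) → List (List ℕ)
  | [] => [[x]]
  | C :: Cs => match intoColumn x C with
      | (C', none) => C' :: Cs
      | (C', some y) => C' :: insert y Cs

/-- The columns of a semistandard Young tableau, from left to right, each from top to bottom. -/
def columns {μ : YoungDiagram} (P : SemistandardYoungTableau μ) : List (List ℕ) :=
  (List.range (μ.rowLen 0)).map fun j => (List.range (μ.colLen j)).map fun i => P i j

/-- A semistandard Young tableau regarded as an array. -/
def toTableau {μ : YoungDiagram} (P : SemistandardYoungTableau μ) : Tableau where
  cols := μ.rowLen 0
  entry r c := if (r, c) ∈ μ then some (P r c) else none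
  entry_eq_none := by
    intro r c h
    rw [if_neg]
    intro hm
    have h0 : (0, c) ∈ μ := μ.up_left_mem (Nat.zero_le r) le_rfl hm
    exact absurd (YoungDiagram.mem_iff_lt_rowLen.1 h0) (not_lt.2 h)

end ColumnInsertion

/-! The argument takes place on the dual side. The perforated arrays in a row-equivalence class
correspond to the strictly monotone column functions on one partial order of the cells
(`IsCellOrder.exists_places`, `IsCellOrder.exists_tableau`). Such functions have a pointwise least
element `h`, which gives the left-justified form. Duality exchanges contents with rows and reverses
the order, so the right-justified form of the dual places its cells in the mirror images of the
columns `h` (`IsRightJustified.places_dual`). Hence a violation entry of the dual is a cell with a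
blank directly above it in the columns `h`, and a right-most violation is one with `h` least
(`IsCellOrder.isSwap_dual`). Raising operators are read off from the least columns of two rows alone
(`IsCellOrder.isRaised_iff`).

By the word condition the dual of `PT` is a semistandard tableau `P`, so the problem is to resolve
`P` with one additional cell `y` in row `ρ`. This cell can be thought of as sitting before column
`j`, starting with `j = 0`. If the box just above column `j` of row `ρ` is empty or holds an entry
at least `y`, the additional cell is the unique candidate for a swap, and the raising operator moves
the same cell one row up (`IsSlot.raisesTo_step`). Otherwise the column entries above are smaller
than `y`, and `y` fits into box `(ρ, j)`. If that box is occupied, its old entry becomes the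
additional cell, now before column `j + 1`. This exchange changes no multiset and costs no swap. If
the box is free, the tableau is semistandard and has no violation. The climb within a column
followed by the exchange is exactly one step of column insertion (`exists_raisesTo`).

Since every stage allows exactly one swap, uniqueness of the resolution and the statement on raising
operators follow formally from `RaisesTo`. -/

namespace PTab

/-! ### Perforated arrays as strictly monotone functions on a finite order -/

/-- The cells of `T` are enumerated by `X`, the cell `x` having content `a x` and lying in row
`r x`, and `lt` is the order in which the columns of these cells have to increase. -/
structure IsCellOrder {ι : Type*} (T : PTab) (X : Finset ι) (a r : ι → ℕ)
    (lt : ι → ι → Prop) : Prop where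
  map_eq : X.val.map (fun x => (a x, r x)) = T
  irrefl : ∀ x ∈ X, ¬ lt x x
  trans : ∀ x ∈ X, ∀ y ∈ X, ∀ z ∈ X, lt x y → lt y z → lt x z
  le_of_lt : ∀ x ∈ X, ∀ y ∈ X, lt x y → a x ≤ a y ∧ r y ≤ r x
  lt_or_lt : ∀ x ∈ X, ∀ y ∈ X, x ≠ y → a x ≤ a y → r y ≤ r x →
    lt x y ∨ (a x = a y ∧ r x = r y ∧ lt y x)

/-- `g` is strictly monotone on `X` with respect to `lt`. -/
def IsColumning {ι : Type*} (X : Finset ι) (lt : ι → ι → Prop) (g : ι → ℕ) : Prop :=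
  ∀ x ∈ X, ∀ y ∈ X, lt x y → g x < g y

/-- The non-blank boxes of `F` are the cells in `X`, the cell `x` lying in column `g x`. -/
def Places {ι : Type*} (X : Finset ι) (a r g : ι → ℕ) (F : Tableau) : Prop :=
  ∀ R c A, F.entry R c = some A ↔ ∃ x ∈ X, r x = R ∧ g x = c ∧ a x = A

/-- `h` is the pointwise least strictly monotone function. -/
def IsLeastColumning {ι : Type*} (X : Finset ι) (lt : ι → ι → Prop) (h : ι → ℕ) : Prop :=
  IsColumning X lt h ∧ ∀ f, IsColumning X lt f → ∀ x ∈ X, h x ≤ f x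

section

variable {ι : Type*} {T : PTab} {X : Finset ι} {a r : ι → ℕ} {lt : ι → ι → Prop}

theorem IsCellOrder.dual (H : IsCellOrder T X a r lt) :
    IsCellOrder T.dual X r a (fun x y => lt y x) where
  map_eq := by rw [← H.map_eq, PTab.dual, Multiset.map_map]; rfl
  irrefl := H.irrefl
  trans x hx y hy z hz h1 h2 := H.trans z hz y hy x hx h2 h1
  le_of_lt x hx y hy h := (H.le_of_lt y hy x hx h).symm
  lt_or_lt x hx y hy hne h1 h2 := by
    rcases H.lt_or_lt y hy x hx hne.symm h2 h1 with h | ⟨h, h', h''⟩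
    · exact Or.inl h
    · exact Or.inr ⟨h'.symm, h.symm, h''⟩

open Classical in
theorem IsCellOrder.count_eq (H : IsCellOrder T X a r lt) (A R : ℕ) :
    T.count (A, R) = (X.filter fun x => a x = A ∧ r x = R).card := by
  rw [← H.map_eq, Multiset.count_map, Finset.card_def, Finset.filter_val]
  congr 1
  refine Multiset.filter_congr fun x _ => ?_
  simp [Prod.ext_iff, eq_comm]

theorem IsCellOrder.ne_of_row (H : IsCellOrder T X a r lt) {g : ι → ℕ}
    (hg : IsColumning X lt g) {x y : ι} (hx : x ∈ X) (hy : y ∈ X)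
    (hr : r x = r y) (hgxy : g x = g y) : x = y := by
  by_contra hne
  rcases le_total (a x) (a y) with h | h
  · rcases H.lt_or_lt x hx y hy hne h hr.ge with h | ⟨_, _, h⟩
    · exact (hg x hx y hy h).ne hgxy
    · exact (hg y hy x hx h).ne hgxy.symm
  · rcases H.lt_or_lt y hy x hx (Ne.symm hne) h hr.le with h | ⟨_, _, h⟩
    · exact (hg y hy x hx h).ne hgxy.symm
    · exact (hg x hx y hy h).ne hgxy

theorem IsCellOrder.lt_of_row (H : IsCellOrder T X a r lt) {g : ι → ℕ}
    (hg : IsColumning X lt g) {x y : ι} (hx : x ∈ X) (hy : y ∈ X)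
    (hr : r x = r y) (hgxy : g x < g y) : lt x y := by
  have hne : x ≠ y := by rintro rfl; exact lt_irrefl _ hgxy
  rcases le_total (a x) (a y) with h | h
  · rcases H.lt_or_lt x hx y hy hne h hr.ge with h | ⟨_, _, h⟩
    · exact h
    · exact absurd (hg y hy x hx h) hgxy.le.not_gt
  · rcases H.lt_or_lt y hy x hx (Ne.symm hne) h hr.le with h | ⟨_, _, h⟩
    · exact absurd (hg y hy x hx h) hgxy.le.not_gt
    · exact h

/-- Every perforated array with the cells of `T` comes from a strictly monotone function. -/
theorem IsCellOrder.exists_places (H : IsCellOrder T X a r lt) {G : Tableau}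
    (hc : T.HasCells G) (hp : IsPerforated G) :
    ∃ g, IsColumning X lt g ∧ Places X a r g G := by
  classical
  have hfin : ∀ A R, {c | G.entry R c = some A}.Finite := fun A R =>
    (Set.finite_lt_nat G.cols).subset fun c hcc => by
      by_contra hlt
      have := G.entry_eq_none R c (not_lt.1 hlt)
      rw [Set.mem_ofPred_eq, this] at hcc
      cases hcc
  have hcard : ∀ A R, (hfin A R).toFinset.card =
      (X.filter fun x => a x = A ∧ r x = R).card := fun A R => by
    rw [← H.count_eq, hc A R]
    congr 1
    ext c
    simp only [Set.Finite.mem_toFinset, Set.mem_ofPred_eq, Finset.mem_filter, Finset.mem_range]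
    refine ⟨fun h => ⟨?_, h⟩, fun h => h.2⟩
    by_contra hlt
    rw [G.entry_eq_none R c (not_lt.1 hlt)] at h
    cases h
  -- Cells with the same content and row are totally ordered by `lt`; the one of rank `n` is sent to
  -- the `n`-th box of that row with that content.
  let rank : ι → ℕ := fun x => (X.filter fun y => (a y = a x ∧ r y = r x) ∧ lt y x).card
  have hrank : ∀ x ∈ X, ∀ y ∈ X, a x = a y → r x = r y → lt x y → rank x < rank y := by
    intro x hx y hy h1 h2 h3
    refine Finset.card_lt_card (Finset.ssubset_iff_subset_ne.2 ⟨?_, ?_⟩)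
    · intro z hz
      simp only [Finset.mem_filter] at hz ⊢
      exact ⟨hz.1, ⟨hz.2.1.1.trans h1, hz.2.1.2.trans h2⟩, H.trans z hz.1 x hx y hy hz.2.2 h3⟩
    · intro he
      have : x ∈ X.filter fun z => (a z = a y ∧ r z = r y) ∧ lt z y := by simp [*]
      rw [← he] at this
      exact H.irrefl x hx (Finset.mem_filter.1 this).2.2
  have hlt : ∀ x ∈ X, rank x < (hfin (a x) (r x)).toFinset.card := by
    intro x hx
    rw [hcard]
    refine Finset.card_lt_card (Finset.ssubset_iff_subset_ne.2 ⟨?_, ?_⟩)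
    · intro z hz
      simp only [Finset.mem_filter] at hz ⊢
      exact ⟨hz.1, hz.2.1⟩
    · intro he
      have : x ∈ X.filter fun z => a z = a x ∧ r z = r x := by simp [*]
      rw [← he] at this
      exact H.irrefl x hx (Finset.mem_filter.1 this).2.2
  let g : ι → ℕ := fun x => Nat.nth (fun c => G.entry (r x) c = some (a x)) (rank x)
  have hentry : ∀ x ∈ X, G.entry (r x) (g x) = some (a x) := fun x hx =>
    Nat.nth_mem (p := fun c => G.entry (r x) c = some (a x)) (rank x) fun _ => hlt x hx
  have hsame : ∀ x ∈ X, ∀ y ∈ X, a x = a y → r x = r y → lt x y → g x < g y := by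
    intro x hx y hy h1 h2 h3
    have := Nat.nth_lt_nth_of_lt_card (hfin (a y) (r y)) (hrank x hx y hy h1 h2 h3) (hlt y hy)
    simpa only [g, h1, h2] using this
  have hcol : IsColumning X lt g := by
    intro x hx y hy h
    obtain ⟨h1, h2⟩ := H.le_of_lt x hx y hy h
    rcases h1.eq_or_lt with ha | ha
    · rcases h2.eq_or_lt with hr | hr
      · exact hsame x hx y hy ha hr.symm h
      · have ex := hentry x hx
        have ey := hentry y hy
        rw [← ha] at ey
        rcases lt_trichotomy (g x) (g y) with h' | h' | h'
        · exact h'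
        · rw [h'] at ex
          exact absurd (hp.strip_col _ _ _ _ ex ey) hr.ne'
        · exact absurd (hp.strip_row _ _ _ _ _ ey ex h') hr.not_ge
    · exact not_le.1 fun h' => hp.order _ _ _ _ _ _ (hentry x hx) (hentry y hy) ha ⟨h2, h'⟩
  refine ⟨g, hcol, fun R c A => ⟨fun h => ?_, ?_⟩⟩
  -- Every box is hit: `g` is injective on cells of equal content and row, and there are as many
  -- such cells as boxes.
  · have himg : (X.filter fun x => a x = A ∧ r x = R).image g = (hfin A R).toFinset := by
      refine Finset.eq_of_subset_of_card_le ?_ ?_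
      · intro c hcc
        obtain ⟨x, hx, rfl⟩ := Finset.mem_image.1 hcc
        obtain ⟨hx', rfl, rfl⟩ := Finset.mem_filter.1 hx
        simpa using hentry x hx'
      · rw [hcard, Finset.card_image_of_injOn]
        intro x hx y hy hxy
        simp only [Finset.coe_filter, Set.mem_ofPred_eq] at hx hy
        exact H.ne_of_row hcol hx.1 hy.1 (hx.2.2.trans hy.2.2.symm) hxy
    have : c ∈ (hfin A R).toFinset := by simpa using h
    rw [← himg] at this
    obtain ⟨x, hx, rfl⟩ := Finset.mem_image.1 this
    obtain ⟨hx', rfl, rfl⟩ := Finset.mem_filter.1 hx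
    exact ⟨x, hx', rfl, rfl, rfl⟩
  · rintro ⟨x, hx, rfl, rfl, rfl⟩
    exact hentry x hx

theorem Places.lt_cols {g : ι → ℕ} {F : Tableau} (hF : Places X a r g F) {x : ι} (hx : x ∈ X) :
    g x < F.cols := by
  by_contra h
  have h1 := (hF (r x) (g x) (a x)).2 ⟨x, hx, rfl, rfl, rfl⟩
  rw [F.entry_eq_none _ _ (not_lt.1 h)] at h1
  cases h1

theorem Places.hasCells (H : IsCellOrder T X a r lt) {g : ι → ℕ} (hg : IsColumning X lt g)
    {F : Tableau} (hF : Places X a r g F) : T.HasCells F := by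
  classical
  intro A R
  rw [H.count_eq]
  refine Finset.card_nbij g ?_ ?_ ?_
  · intro x hx
    obtain ⟨hx', rfl, rfl⟩ := Finset.mem_filter.1 hx
    simp only [Finset.coe_filter, Finset.mem_range, Set.mem_ofPred_eq]
    exact ⟨hF.lt_cols hx', (hF _ _ _).2 ⟨x, hx', rfl, rfl, rfl⟩⟩
  · intro x hx y hy hxy
    simp only [Finset.coe_filter, Set.mem_ofPred_eq] at hx hy
    exact H.ne_of_row hg hx.1 hy.1 (hx.2.2.trans hy.2.2.symm) hxy
  · intro c hcc
    simp only [Finset.coe_filter, Finset.mem_range, Set.mem_ofPred_eq] at hcc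
    obtain ⟨x, hx, rfl, rfl, rfl⟩ := (hF _ _ _).1 hcc.2
    exact ⟨x, by simp [hx], rfl⟩

theorem Places.isPerforated (H : IsCellOrder T X a r lt) {g : ι → ℕ} (hg : IsColumning X lt g)
    {F : Tableau} (hF : Places X a r g F) : IsPerforated F := by
  have key : ∀ x ∈ X, ∀ y ∈ X, a x ≤ a y → r y ≤ r x → g y ≤ g x → r x = r y ∧ a x = a y := by
    intro x hx y hy h1 h2 h3
    by_cases hxy : x = y
    · subst hxy; exact ⟨rfl, rfl⟩
    · rcases H.lt_or_lt x hx y hy hxy h1 h2 with h | h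
      · exact absurd (hg x hx y hy h) h3.not_gt
      · exact ⟨h.2.1, h.1⟩
  refine ⟨?_, ?_, ?_⟩
  · intro A R R' c h h'
    obtain ⟨x, hx, rfl, rfl, rfl⟩ := (hF _ _ _).1 h
    obtain ⟨y, hy, rfl, hgy, hay⟩ := (hF _ _ _).1 h'
    rcases le_total (r x) (r y) with hr | hr
    · exact (key y hy x hx hay.le hr hgy.ge).1.symm
    · exact (key x hx y hy hay.ge hr hgy.le).1
  · intro A R R' c c' h h' hcc
    obtain ⟨x, hx, rfl, rfl, rfl⟩ := (hF _ _ _).1 h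
    obtain ⟨y, hy, rfl, rfl, hay⟩ := (hF _ _ _).1 h'
    by_contra hr
    exact hr (key y hy x hx hay.le (not_le.1 hr).le hcc.le).1.le
  · rintro A B R R' c c' h h' hab ⟨h1, h2⟩
    obtain ⟨x, hx, rfl, rfl, rfl⟩ := (hF _ _ _).1 h
    obtain ⟨y, hy, rfl, rfl, rfl⟩ := (hF _ _ _).1 h'
    exact hab.ne (key x hx y hy hab.le h1 h2).2

/-- A strictly monotone function bounded by `N` gives an array with `N` columns. -/
theorem IsCellOrder.exists_tableau (H : IsCellOrder T X a r lt) {g : ι → ℕ}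
    (hg : IsColumning X lt g) {N : ℕ} (hN : ∀ x ∈ X, g x < N) :
    ∃ F : Tableau, F.cols = N ∧ Places X a r g F := by
  classical
  refine ⟨⟨N, fun R c => if h : ∃ x ∈ X, r x = R ∧ g x = c then some (a h.choose) else none,
    fun R c hc => dif_neg ?_⟩, rfl, fun R c A => ?_⟩
  · rintro ⟨x, hx, _, rfl⟩
    exact (hN x hx).not_ge hc
  · constructor
    · intro h
      by_cases hex : ∃ x ∈ X, r x = R ∧ g x = c
      · simp only [dif_pos hex, Option.some.injEq] at h
        have := hex.choose_spec
        exact ⟨hex.choose, this.1, this.2.1, this.2.2, h⟩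
      · simp [dif_neg hex] at h
    · rintro ⟨x, hx, hr, hc, rfl⟩
      have hex : ∃ x ∈ X, r x = R ∧ g x = c := ⟨x, hx, hr, hc⟩
      have hs := hex.choose_spec
      have : hex.choose = x :=
        H.ne_of_row hg hs.1 hx (hs.2.1.trans hr.symm) (hs.2.2.trans hc.symm)
      simp only [dif_pos hex, this]

open Classical in
/-- The position of `x` in its row. -/
noncomputable def rowIndex (X : Finset ι) (r : ι → ℕ) (lt : ι → ι → Prop) (x : ι) : ℕ :=
  (X.filter fun y => r y = r x ∧ lt y x).card

-- The right-hand side does not involve `g`: a cell has the same position in its row in every array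
-- of the class. Comparing `cellCol` of two forms thus means comparing their column functions cell
-- by cell.
open Classical in
theorem Places.count_eq (H : IsCellOrder T X a r lt) {g : ι → ℕ} (hg : IsColumning X lt g)
    {F : Tableau} (hF : Places X a r g F) {x : ι} (hx : x ∈ X) :
    Nat.count (fun c => F.entry (r x) c ≠ none) (g x) = rowIndex X r lt x := by
  rw [Nat.count_eq_card_filter_range, rowIndex]
  symm
  refine Finset.card_nbij g ?_ ?_ ?_
  · intro y hy
    obtain ⟨hy, hr, hl⟩ := Finset.mem_filter.1 hy
    simp only [Finset.coe_filter, Finset.mem_range, Set.mem_ofPred_eq]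
    rw [(hF (r x) (g y) (a y)).2 ⟨y, hy, hr, rfl, rfl⟩]
    exact ⟨hg y hy x hx hl, by simp⟩
  · intro y hy z hz hyz
    simp only [Finset.coe_filter, Set.mem_ofPred_eq] at hy hz
    exact H.ne_of_row hg hy.1 hz.1 (hy.2.1.trans hz.2.1.symm) hyz
  · intro c hcc
    simp only [Finset.coe_filter, Finset.mem_range, Set.mem_ofPred_eq] at hcc
    obtain ⟨A, hA⟩ := Option.ne_none_iff_exists'.1 hcc.2
    obtain ⟨y, hy, hr, rfl, rfl⟩ := (hF _ _ _).1 hA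
    exact ⟨y, by simpa [hy, hr] using H.lt_of_row hg hy hx hr hcc.1, rfl⟩

theorem Places.cellCol_rowIndex (H : IsCellOrder T X a r lt) {g : ι → ℕ}
    (hg : IsColumning X lt g) {F : Tableau} (hF : Places X a r g F) {x : ι} (hx : x ∈ X) :
    cellCol F (r x) (rowIndex X r lt x) = g x := by
  classical
  rw [cellCol, ← hF.count_eq H hg hx, Nat.nth_count]
  rw [(hF (r x) (g x) (a x)).2 ⟨x, hx, rfl, rfl, rfl⟩]
  simp

/-- Past the last cell of a row `Nat.nth` takes the value `0`, so inequalities between columns need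
checking only at genuine cells. -/
theorem Places.cellCol_cases (H : IsCellOrder T X a r lt) {g : ι → ℕ}
    (hg : IsColumning X lt g) {F : Tableau} (hF : Places X a r g F) (R p : ℕ) :
    (∃ x ∈ X, r x = R ∧ rowIndex X r lt x = p) ∨ cellCol F R p = 0 := by
  classical
  have hfin : {c | F.entry R c ≠ none}.Finite :=
    (Set.finite_lt_nat F.cols).subset fun c hcc => by
      by_contra hlt
      exact hcc (F.entry_eq_none R c (not_lt.1 hlt))
  rcases lt_or_ge p hfin.toFinset.card with hp | hp
  · left
    have hmem := Nat.nth_mem (p := fun c => F.entry R c ≠ none) p fun _ => hp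
    obtain ⟨A, hA⟩ := Option.ne_none_iff_exists'.1 hmem
    obtain ⟨x, hx, rfl, hgx, rfl⟩ := (hF _ _ _).1 hA
    refine ⟨x, hx, rfl, ?_⟩
    rw [← hF.count_eq H hg hx, hgx]
    exact Nat.count_nth fun _ => hp
  · right
    exact Nat.nth_of_card_le hfin hp

/-! ### Least columns and the justified forms -/

theorem IsCellOrder.exists_isLeastColumning (H : IsCellOrder T X a r lt) :
    ∃ h, IsLeastColumning X lt h := by
  classical
  -- Counting predecessors is strictly monotone, so the pointwise minimum over all strictly monotone
  -- functions exists; it is again strictly monotone.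
  have hne : ∃ f, IsColumning X lt f := by
    refine ⟨fun x => (X.filter fun y => lt y x).card, fun x hx y hy hxy => ?_⟩
    refine Finset.card_lt_card (Finset.ssubset_iff_subset_ne.2 ⟨?_, ?_⟩)
    · intro z hz
      simp only [Finset.mem_filter] at hz ⊢
      exact ⟨hz.1, H.trans z hz.1 x hx y hy hz.2 hxy⟩
    · intro he
      have : x ∈ X.filter fun z => lt z y := by simp [*]
      rw [← he] at this
      exact H.irrefl x hx (Finset.mem_filter.1 this).2
  have hex : ∀ x, ∃ n f, IsColumning X lt f ∧ f x = n := fun x =>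
    let ⟨f, hf⟩ := hne; ⟨f x, f, hf, rfl⟩
  refine ⟨fun x => Nat.find (hex x), fun x hx y hy hxy => ?_, fun f hf x _ =>
    Nat.find_min' (hex x) ⟨f, hf, rfl⟩⟩
  obtain ⟨f, hf, hfy⟩ := Nat.find_spec (hex y)
  exact (Nat.find_min' (hex x) ⟨f, hf, rfl⟩).trans_lt ((hf x hx y hy hxy).trans_eq hfy)

theorem Places.isForm (H : IsCellOrder T X a r lt) {h : ι → ℕ} (hh : IsLeastColumning X lt h)
    {F : Tableau} (hF : Places X a r h F) (hcols : ∀ N, (∀ x ∈ X, h x < N) → F.cols ≤ N) :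
    T.IsForm F := by
  refine ⟨hF.hasCells H hh.1, hF.isPerforated H hh.1, fun G hc hp => ?_⟩
  obtain ⟨g, hg, hG⟩ := H.exists_places hc hp
  exact hcols _ fun x hx => (hh.2 g hg x hx).trans_lt (hG.lt_cols hx)

theorem Places.isLeftJustified (H : IsCellOrder T X a r lt) {h : ι → ℕ}
    (hh : IsLeastColumning X lt h) {F : Tableau} (hF : Places X a r h F)
    (hcols : ∀ N, (∀ x ∈ X, h x < N) → F.cols ≤ N) : T.IsLeftJustified F := by
  refine ⟨hF.isForm H hh hcols, fun G hGf R p => ?_⟩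
  obtain ⟨g, hg, hG⟩ := H.exists_places hGf.1 hGf.2.1
  rcases hF.cellCol_cases H hh.1 R p with ⟨x, hx, rfl, rfl⟩ | h0
  · rw [hF.cellCol_rowIndex H hh.1 hx, hG.cellCol_rowIndex H hg hx]
    exact hh.2 g hg x hx
  · rw [h0]; exact Nat.zero_le _

theorem IsCellOrder.exists_isLeftJustified (H : IsCellOrder T X a r lt) :
    ∃ F, T.IsLeftJustified F := by
  obtain ⟨h, hh⟩ := H.exists_isLeastColumning
  obtain ⟨F, hN, hF⟩ := H.exists_tableau hh.1 (N := X.sup fun x => h x + 1)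
    fun x hx => Finset.le_sup (f := fun x => h x + 1) hx
  exact ⟨F, hF.isLeftJustified H hh fun N hN' => hN ▸ Finset.sup_le fun x hx => hN' x hx⟩

/-- The cells of the left-justified form lie in the least possible columns. -/
theorem IsLeftJustified.places (H : IsCellOrder T X a r lt) {h : ι → ℕ}
    (hh : IsLeastColumning X lt h) {L : Tableau} (hL : T.IsLeftJustified L) :
    Places X a r h L := by
  obtain ⟨l, hl, hLl⟩ := H.exists_places hL.1.1 hL.1.2.1
  obtain ⟨F, hN, hF⟩ := H.exists_tableau hh.1 (N := L.cols)
    fun x hx => (hh.2 l hl x hx).trans_lt (hLl.lt_cols hx)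
  -- Any bound for `h` is the width of some array of the class, so `L.cols` is no larger than that
  -- bound.
  have hFf : T.IsForm F := hF.isForm H hh fun N hN' => by
    obtain ⟨G, hG, hG'⟩ := H.exists_tableau hh.1 hN'
    rw [hN, ← hG]
    exact hL.1.2.2 G (hG'.hasCells H hh.1) (hG'.isPerforated H hh.1)
  have heq : ∀ x ∈ X, l x = h x := fun x hx => by
    refine le_antisymm ?_ (hh.2 l hl x hx)
    have := hL.2 F hFf (r x) (rowIndex X r lt x)
    rwa [hLl.cellCol_rowIndex H hl hx, hF.cellCol_rowIndex H hh.1 hx] at this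
  intro R c A
  rw [hLl R c A]
  exact exists_congr fun x => and_congr_right fun hx => by rw [heq x hx]

theorem IsColumning.reverse {g : ι → ℕ} (hg : IsColumning X lt g) {N : ℕ}
    (hN : ∀ x ∈ X, g x < N) : IsColumning X (fun x y => lt y x) fun x => N - 1 - g x := by
  intro x hx y hy hxy
  have := hg y hy x hx hxy
  have := hN x hx
  show N - 1 - g x < N - 1 - g y
  omega

/-- The cells of the right-justified form of the dual lie in the columns opposite to the least
possible ones. -/
theorem IsRightJustified.places_dual (H : IsCellOrder T X a r lt) {h : ι → ℕ}
    (hh : IsLeastColumning X lt h) {R : Tableau} (hR : T.dual.IsRightJustified R) :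
    (∀ x ∈ X, h x < R.cols) ∧ Places X r a (fun x => R.cols - 1 - h x) R := by
  obtain ⟨g, hg, hG⟩ := H.dual.exists_places hR.1.1 hR.1.2.1
  have hg' : IsColumning X lt fun x => R.cols - 1 - g x := hg.reverse fun x hx => hG.lt_cols hx
  have hle : ∀ x ∈ X, h x ≤ R.cols - 1 - g x := hh.2 _ hg'
  have hlt : ∀ x ∈ X, h x < R.cols := fun x hx => by
    have := hle x hx
    have := hG.lt_cols hx
    omega
  obtain ⟨F, hN, hF⟩ := H.dual.exists_tableau (hh.1.reverse hlt) (N := R.cols)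
    fun x hx => by have := hlt x hx; omega
  have hFf : T.dual.IsForm F := ⟨hF.hasCells H.dual (hh.1.reverse hlt),
    hF.isPerforated H.dual (hh.1.reverse hlt), fun G h1 h2 => hN ▸ hR.1.2.2 G h1 h2⟩
  refine ⟨hlt, ?_⟩
  have heq : ∀ x ∈ X, g x = R.cols - 1 - h x := fun x hx => by
    refine le_antisymm ?_ ?_
    · have := hle x hx
      have := hG.lt_cols hx
      omega
    · have := hR.2 F hFf (a x) (rowIndex X a (fun x y => lt y x) x)
      rwa [hG.cellCol_rowIndex H.dual hg hx,
        hF.cellCol_rowIndex H.dual (hh.1.reverse hlt) hx] at this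
  intro R' c A
  rw [hG R' c A]
  exact exists_congr fun x => and_congr_right fun hx => by rw [heq x hx]

theorem IsCellOrder.exists_isRightJustified_dual (H : IsCellOrder T X a r lt) :
    ∃ R, T.dual.IsRightJustified R := by
  obtain ⟨h, hh⟩ := H.exists_isLeastColumning
  set N := X.sup fun x => h x + 1 with hN
  have hlt : ∀ x ∈ X, h x < N := fun x hx => Finset.le_sup (f := fun x => h x + 1) hx
  obtain ⟨F, hFN, hF⟩ := H.dual.exists_tableau (hh.1.reverse hlt) (N := N)
    fun x hx => by have := hlt x hx; omega
  have hmin : ∀ G : Tableau, T.dual.HasCells G → IsPerforated G → F.cols ≤ G.cols := by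
    intro G h1 h2
    obtain ⟨g, hg, hG⟩ := H.dual.exists_places h1 h2
    have hg' : IsColumning X lt fun x => G.cols - 1 - g x := hg.reverse fun x hx => hG.lt_cols hx
    rw [hFN, hN]
    refine Finset.sup_le fun x hx => ?_
    have := hh.2 _ hg' x hx
    have := hG.lt_cols hx
    omega
  have hFf : T.dual.IsForm F := ⟨hF.hasCells H.dual (hh.1.reverse hlt),
    hF.isPerforated H.dual (hh.1.reverse hlt), hmin⟩
  refine ⟨F, hFf, fun G hGf R p => ?_⟩
  obtain ⟨g, hg, hG⟩ := H.dual.exists_places hGf.1 hGf.2.1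
  have hg' : IsColumning X lt fun x => G.cols - 1 - g x := hg.reverse fun x hx => hG.lt_cols hx
  rcases hG.cellCol_cases H.dual hg R p with ⟨x, hx, rfl, rfl⟩ | h0
  · rw [hF.cellCol_rowIndex H.dual (hh.1.reverse hlt) hx, hG.cellCol_rowIndex H.dual hg hx]
    have := hh.2 _ hg' x hx
    have := hG.lt_cols hx
    have := hGf.2.2 F hFf.1 hFf.2.1
    omega
  · rw [h0]; exact Nat.zero_le _

/-! ### Swaps and raising operators in terms of the least columns -/

/-- The cell `x` has no cell directly above it when all cells are in the columns `h`. -/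
def HasBlankAbove (X : Finset ι) (r h : ι → ℕ) (i : ℕ) (x : ι) : Prop :=
  r x = i + 1 ∧ ∀ z ∈ X, r z = i → h z ≠ h x

/-- Contents of the dual are rows here, and reversing the columns preserves which cells share a
column. -/
theorem isViolation_iff {h : ι → ℕ} {R : Tableau} (hlt : ∀ x ∈ X, h x < R.cols)
    (hR : Places X r a (fun x => R.cols - 1 - h x) R) (i p c : ℕ) :
    IsViolation R i p c ↔
      ∃ x ∈ X, HasBlankAbove X r h i x ∧ a x = p ∧ R.cols - 1 - h x = c := by
  constructor
  · rintro ⟨h1, h2⟩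
    obtain ⟨x, hx, hax, hc, hrx⟩ := (hR _ _ _).1 h1
    refine ⟨x, hx, ⟨hrx, fun z hz hrz hzx => ?_⟩, hax, hc⟩
    exact h2 (a z) ((hR _ _ _).2 ⟨z, hz, rfl, by simp only [← hc, hzx], hrz⟩)
  · rintro ⟨x, hx, ⟨hrx, hbl⟩, hax, hc⟩
    refine ⟨(hR _ _ _).2 ⟨x, hx, hax, hc, hrx⟩, fun p' hp' => ?_⟩
    obtain ⟨z, hz, _, hcz, hrz⟩ := (hR _ _ _).1 hp'
    have := hlt x hx
    have := hlt z hz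
    refine hbl z hz hrz ?_
    dsimp only at hcz
    omega

/-- Reversal of columns turns a right-most violation of the dual into a blank-above cell in the
least column. -/
theorem IsCellOrder.isSwap_dual (H : IsCellOrder T X a r lt) {h : ι → ℕ}
    (hh : IsLeastColumning X lt h) {i : ℕ} {T' : PTab} :
    IsSwap i T.dual T' ↔ ∃ x ∈ X, HasBlankAbove X r h i x ∧
      (∀ i', ∀ x' ∈ X, HasBlankAbove X r h i' x' → h x ≤ h x') ∧
      T' = (i, a x) ::ₘ T.dual.erase (i + 1, a x) := by
  constructor
  · rintro ⟨R, hR, p, c, hv, hmax, rfl⟩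
    obtain ⟨hlt, hpl⟩ := hR.places_dual H hh
    obtain ⟨x, hx, hbl, rfl, rfl⟩ := (isViolation_iff hlt hpl _ _ _).1 hv
    refine ⟨x, hx, hbl, fun i' x' hx' hbl' => ?_, rfl⟩
    have := hmax i' _ _ ((isViolation_iff hlt hpl _ _ _).2 ⟨x', hx', hbl', rfl, rfl⟩)
    have := hlt x hx
    have := hlt x' hx'
    omega
  · rintro ⟨x, hx, hbl, hmin, rfl⟩
    obtain ⟨R, hR⟩ := H.exists_isRightJustified_dual
    obtain ⟨hlt, hpl⟩ := hR.places_dual H hh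
    refine ⟨R, hR, _, _, (isViolation_iff hlt hpl _ _ _).2 ⟨x, hx, hbl, rfl, rfl⟩,
      fun i' p' c' hv => ?_, rfl⟩
    obtain ⟨x', hx', hbl', rfl, rfl⟩ := (isViolation_iff hlt hpl _ _ _).1 hv
    have := hmin i' x' hx' hbl'
    omega

theorem IsCellOrder.noViolation_dual (H : IsCellOrder T X a r lt) {h : ι → ℕ}
    (hh : IsLeastColumning X lt h) :
    NoViolation T.dual ↔ ∀ i, ∀ x ∈ X, ¬ HasBlankAbove X r h i x := by
  constructor
  · rintro ⟨R, hR, hv⟩ i x hx hbl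
    obtain ⟨hlt, hpl⟩ := hR.places_dual H hh
    exact hv _ _ _ ((isViolation_iff hlt hpl _ _ _).2 ⟨x, hx, hbl, rfl, rfl⟩)
  · intro hno
    obtain ⟨R, hR⟩ := H.exists_isRightJustified_dual
    obtain ⟨hlt, hpl⟩ := hR.places_dual H hh
    refine ⟨R, hR, fun i p c hv => ?_⟩
    obtain ⟨x, hx, hbl, _, _⟩ := (isViolation_iff hlt hpl _ _ _).1 hv
    exact hno i x hx hbl

theorem IsCellOrder.twoRows (H : IsCellOrder T X a r lt) (i : ℕ) :
    IsCellOrder (T.twoRows i) (X.filter fun x => r x = i ∨ r x = i + 1) a r lt where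
  map_eq := by
    rw [← H.map_eq, PTab.twoRows, Multiset.filter_map, Finset.filter_val]
    rfl
  irrefl x hx := H.irrefl x (Finset.mem_filter.1 hx).1
  trans x hx y hy z hz := H.trans x (Finset.mem_filter.1 hx).1 y (Finset.mem_filter.1 hy).1
    z (Finset.mem_filter.1 hz).1
  le_of_lt x hx y hy := H.le_of_lt x (Finset.mem_filter.1 hx).1 y (Finset.mem_filter.1 hy).1
  lt_or_lt x hx y hy := H.lt_or_lt x (Finset.mem_filter.1 hx).1 y (Finset.mem_filter.1 hy).1

/-- Here `h` is least for the rows `i` and `i + 1` alone; it may differ from the least columns of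
all cells, which govern swaps. -/
theorem IsCellOrder.isRaised_iff (H : IsCellOrder T X a r lt) {i : ℕ} {h : ι → ℕ}
    (hh : IsLeastColumning (X.filter fun x => r x = i ∨ r x = i + 1) lt h) (A : ℕ) :
    T.IsRaised i A ↔ ∃ x ∈ X, a x = A ∧ HasBlankAbove X r h i x ∧
      ∀ x' ∈ X, h x < h x' → ¬ HasBlankAbove X r h i x' := by
  have mem : ∀ {x : ι}, x ∈ X → (r x = i ∨ r x = i + 1) →
      x ∈ X.filter fun x => r x = i ∨ r x = i + 1 := fun h1 h2 => Finset.mem_filter.2 ⟨h1, h2⟩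
  have key : ∀ L, (T.twoRows i).IsLeftJustified L → ∀ x ∈ X, r x = i + 1 →
      (L.entry i (h x) = none ↔ HasBlankAbove X r h i x) := by
    intro L hL x hx hrx
    have hpl := hL.places (H.twoRows i) hh
    constructor
    · intro he
      refine ⟨hrx, fun z hz hrz hzx => ?_⟩
      rw [(hpl _ _ _).2 ⟨z, mem hz (Or.inl hrz), hrz, hzx, rfl⟩] at he
      cases he
    · rintro ⟨_, hb⟩
      by_contra he
      obtain ⟨A, hA⟩ := Option.ne_none_iff_exists'.1 he
      obtain ⟨z, hz, hrz, hzx, _⟩ := (hpl _ _ _).1 hA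
      exact hb z (Finset.mem_filter.1 hz).1 hrz hzx
  constructor
  · rintro ⟨L, hL, c, hA, hb, hmax⟩
    have hpl := hL.places (H.twoRows i) hh
    obtain ⟨x, hx, hrx, rfl, rfl⟩ := (hpl _ _ _).1 hA
    have hx := (Finset.mem_filter.1 hx).1
    refine ⟨x, hx, rfl, (key L hL x hx hrx).1 hb, fun x' hx' hlt hbl => ?_⟩
    refine hmax _ hlt ?_ ((key L hL x' hx' hbl.1).2 hbl)
    rw [(hpl _ _ _).2 ⟨x', mem hx' (Or.inr hbl.1), hbl.1, rfl, rfl⟩]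
    simp
  · rintro ⟨x, hx, rfl, hbl, hmax⟩
    obtain ⟨L, hL⟩ := (H.twoRows i).exists_isLeftJustified
    have hpl := hL.places (H.twoRows i) hh
    refine ⟨L, hL, h x, (hpl _ _ _).2 ⟨x, mem hx (Or.inr hbl.1), hbl.1, rfl, rfl⟩,
      (key L hL x hx hbl.1).2 hbl, fun c hc hne hnone => ?_⟩
    obtain ⟨A, hA⟩ := Option.ne_none_iff_exists'.1 hne
    obtain ⟨z, hz, hrz, rfl, _⟩ := (hpl _ _ _).1 hA
    have hz := (Finset.mem_filter.1 hz).1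
    exact hmax z hz hc ((key L hL z hz hrz).1 hnone)

/-- The choice in the definition of `e` is harmless: two cells of one row never share a column, so
the right-most candidate is unique. -/
theorem IsCellOrder.e_eq_some (H : IsCellOrder T X a r lt) {i : ℕ} {h : ι → ℕ}
    (hh : IsLeastColumning (X.filter fun x => r x = i ∨ r x = i + 1) lt h) {x : ι} (hx : x ∈ X)
    (hbl : HasBlankAbove X r h i x)
    (hmax : ∀ x' ∈ X, h x < h x' → ¬ HasBlankAbove X r h i x') :
    e i T = some ((a x, i) ::ₘ T.erase (a x, i + 1)) := by
  have hex : ∃ A, T.IsRaised i A := ⟨a x, (H.isRaised_iff hh _).2 ⟨x, hx, rfl, hbl, hmax⟩⟩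
  obtain ⟨y, hy, hya, hyb, hym⟩ := (H.isRaised_iff hh _).1 hex.choose_spec
  have hxy : y = x := by
    refine (H.twoRows i).ne_of_row hh.1 (Finset.mem_filter.2 ⟨hy, Or.inr hyb.1⟩)
      (Finset.mem_filter.2 ⟨hx, Or.inr hbl.1⟩) (hyb.1.trans hbl.1.symm) ?_
    rcases lt_trichotomy (h y) (h x) with h' | h' | h'
    · exact absurd hbl (hym x hx h')
    · exact h'
    · exact absurd hyb (hmax y hy h')
  subst hxy
  rw [e, dif_pos hex, ← hya]

theorem IsCellOrder.e_eq_none (H : IsCellOrder T X a r lt) {i : ℕ} {h : ι → ℕ}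
    (hh : IsLeastColumning (X.filter fun x => r x = i ∨ r x = i + 1) lt h)
    (hno : ∀ x ∈ X, ¬ HasBlankAbove X r h i x) : e i T = none := by
  rw [e, dif_neg]
  rintro ⟨A, hA⟩
  obtain ⟨x, hx, _, hbl, _⟩ := (H.isRaised_iff hh _).1 hA
  exact hno x hx hbl

/-- Cells whose columns in some array increase in the required way. -/
theorem isCellOrder_of_pos (pos : ι → ℕ)
    (hpos : ∀ x ∈ X, ∀ y ∈ X, x ≠ y → a x ≤ a y → r y ≤ r x →
      pos x < pos y ∨ (a x = a y ∧ r x = r y ∧ pos y < pos x)) :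
    IsCellOrder (X.val.map fun x => (a x, r x)) X a r
      (fun x y => a x ≤ a y ∧ r y ≤ r x ∧ pos x < pos y) where
  map_eq := rfl
  irrefl x _ h := lt_irrefl _ h.2.2
  trans x _ y _ z _ h1 h2 := ⟨h1.1.trans h2.1, h2.2.1.trans h1.2.1, h1.2.2.trans h2.2.2⟩
  le_of_lt x _ y _ h := ⟨h.1, h.2.1⟩
  lt_or_lt x hx y hy hne h1 h2 := by
    rcases hpos x hx y hy hne h1 h2 with h | ⟨h, h', h''⟩
    · exact Or.inl ⟨h1, h2, h⟩
    · exact Or.inr ⟨h, h', h.ge, h'.le, h''⟩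

end

end PTab
-- Resolution as a deterministic process
namespace PTab

open ColumnInsertion

theorem dual_dual (T : PTab) : T.dual.dual = T := by
  simp [dual, Multiset.map_map]

/-- The deterministic resolution of the dual of a ptableau, together with the raising operators
which it corresponds to. -/
inductive RaisesTo : PTab → PTab → Prop
  | done {Q : PTab} : NoViolation Q.dual → (∀ i T, ¬ IsSwap i Q.dual T) →
      IsHighestWeight Q → RaisesTo Q Q
  | step {Q Q₁ Q₂ : PTab} {i : ℕ} : IsSwap i Q.dual Q₁.dual →
      (∀ i' T, IsSwap i' Q.dual T → i' = i ∧ T = Q₁.dual) → ¬ NoViolation Q.dual →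
      e i Q = some Q₁ → RaisesTo Q₁ Q₂ → RaisesTo Q Q₂

theorem RaisesTo.isHighestWeight {Q Q' : PTab} (h : RaisesTo Q Q') : IsHighestWeight Q' := by
  induction h with
  | done _ _ h => exact h
  | step _ _ _ _ _ ih => exact ih

/-- At each stage the next swap is forced, and stopping early is excluded because a violation
remains. -/
theorem RaisesTo.isResolution_iff {Q Q' : PTab} (h : RaisesTo Q Q') (T : PTab) :
    IsResolution Q.dual T ↔ T = Q'.dual := by
  induction h with
  | done hno hsw _ =>
    constructor
    · rintro ⟨h, _⟩
      rcases Relation.ReflTransGen.cases_head h with h | ⟨_, ⟨i, h⟩, _⟩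
      · exact h.symm
      · exact absurd h (hsw _ _)
    · rintro rfl
      exact ⟨Relation.ReflTransGen.refl, hno⟩
  | step hsw huniq hno _ _ ih =>
    rw [← ih]
    constructor
    · rintro ⟨h, hT⟩
      rcases Relation.ReflTransGen.cases_head h with rfl | ⟨_, ⟨i, h⟩, h'⟩
      · exact absurd hT hno
      · obtain ⟨_, rfl⟩ := huniq _ _ h
        exact ⟨h', hT⟩
    · rintro ⟨h, hT⟩
      exact ⟨Relation.ReflTransGen.head ⟨_, hsw⟩ h, hT⟩

/-- Any run of swaps follows the forced path, so its next swap is one of the recorded steps. -/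
theorem RaisesTo.e_dual {Q Q' : PTab} (h : RaisesTo Q Q') {T T' : PTab} {i : ℕ}
    (hT : Swaps Q.dual T) (hi : IsSwap i T T') : e i T.dual = some T'.dual := by
  induction h with
  | done hno hsw _ =>
    rcases Relation.ReflTransGen.cases_head hT with rfl | ⟨_, ⟨i', h⟩, _⟩
    · exact absurd hi (hsw _ _)
    · exact absurd h (hsw _ _)
  | step hsw huniq hno he _ ih =>
    rcases Relation.ReflTransGen.cases_head hT with rfl | ⟨_, ⟨i', h⟩, h'⟩
    · obtain ⟨rfl, rfl⟩ := huniq _ _ hi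
      rw [dual_dual, dual_dual, he]
    · obtain ⟨_, rfl⟩ := huniq _ _ h
      exact ih h'

/-! ### Semistandard tableaux as ptableaux -/

section Semistandard

variable {μ : YoungDiagram}

/-- The cells of a semistandard Young tableau. -/
def ofSemistandard (S : SemistandardYoungTableau μ) : PTab :=
  μ.cells.val.map fun x => (S x.1 x.2, x.1)

/-- The order of the cells of a semistandard Young tableau. -/
def cellLT (S : SemistandardYoungTableau μ) (x y : ℕ × ℕ) : Prop :=
  S x.1 x.2 ≤ S y.1 y.2 ∧ y.1 ≤ x.1 ∧ x.2 < y.2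

/-- If `y` were weakly left of `x` and strictly above it, going right along the row of `y` and then
down to `x` would make the content of `y` strictly smaller. In the same row, weak increase forces
equal contents. -/
theorem col_lt_of_le (S : SemistandardYoungTableau μ) {x y : ℕ × ℕ} (hx : x ∈ μ) (hne : x ≠ y)
    (h1 : S x.1 x.2 ≤ S y.1 y.2) (h2 : y.1 ≤ x.1) :
    x.2 < y.2 ∨ (S x.1 x.2 = S y.1 y.2 ∧ x.1 = y.1 ∧ y.2 < x.2) := by
  rcases lt_or_ge x.2 y.2 with h | h
  · exact Or.inl h
  right
  have hm : (y.1, x.2) ∈ μ := μ.up_left_mem h2 le_rfl hx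
  have h3 := S.row_weak_of_le h hm
  rcases h2.eq_or_lt with he | hl
  · rw [he] at h3
    refine ⟨le_antisymm h1 (he ▸ h3), he.symm, lt_of_le_of_ne h fun h' => hne ?_⟩
    exact Prod.ext he.symm h'.symm
  · have := S.col_strict hl (j := x.2) hx
    omega

theorem isCellOrder_ofSemistandard (S : SemistandardYoungTableau μ) :
    IsCellOrder (ofSemistandard S) μ.cells (fun x => S x.1 x.2) Prod.fst (cellLT S) :=
  isCellOrder_of_pos Prod.snd fun _ hx _ _ hne => col_lt_of_le S ((YoungDiagram.mem_cells _).1 hx) hne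

/-- Each row is a chain, so its `c`-th cell needs `c` columns to its left. Allowing a subset `X`
covers both the whole tableau and two of its rows. -/
theorem isLeastColumning_snd (S : SemistandardYoungTableau μ) {X : Finset (ℕ × ℕ)}
    (hX : X ⊆ μ.cells) (hrow : ∀ i c, (i, c + 1) ∈ X → (i, c) ∈ X) :
    IsLeastColumning X (cellLT S) Prod.snd := by
  refine ⟨fun x _ y _ h => h.2.2, fun f hf => ?_⟩
  have key : ∀ c i, (i, c) ∈ X → c ≤ f (i, c) := by
    intro c
    induction c with
    | zero => intro i _; exact Nat.zero_le _
    | succ c ih =>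
      intro i h
      have h' := hrow i c h
      have hm : (i, c + 1) ∈ μ := (YoungDiagram.mem_cells _).1 (hX h)
      have := hf _ h' _ h ⟨S.row_weak (Nat.lt_succ_self c) hm, le_rfl, Nat.lt_succ_self c⟩
      have := ih i h'
      omega
  exact fun x hx => key x.2 x.1 hx

theorem isLeastColumning_cells (S : SemistandardYoungTableau μ) :
    IsLeastColumning μ.cells (cellLT S) Prod.snd :=
  isLeastColumning_snd S subset_rfl fun i c h => by
    rw [YoungDiagram.mem_cells] at h ⊢
    exact μ.up_left_mem le_rfl (Nat.le_succ c) h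

/-- A semistandard Young tableau is its own left-justified form. -/
theorem isLeftJustified_toTableau (S : SemistandardYoungTableau μ) :
    (ofSemistandard S).IsLeftJustified (toTableau S) := by
  refine Places.isLeftJustified (isCellOrder_ofSemistandard S) (isLeastColumning_cells S) ?_ ?_
  · intro R c A
    simp only [toTableau, YoungDiagram.mem_cells]
    constructor
    · intro h
      split_ifs at h with hm
      exact ⟨(R, c), hm, rfl, rfl, Option.some.inj h⟩
    · rintro ⟨x, hx, rfl, rfl, rfl⟩
      exact if_pos hx
  · intro N hN
    show μ.rowLen 0 ≤ N
    rcases Nat.eq_zero_or_pos (μ.rowLen 0) with h | h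
    · omega
    · have := hN (0, μ.rowLen 0 - 1)
        ((YoungDiagram.mem_cells _).2 (YoungDiagram.mem_iff_lt_rowLen.2 (by omega)))
      dsimp only at this
      omega

theorem not_hasBlankAbove_cells (i : ℕ) : ∀ x ∈ μ.cells,
    ¬ HasBlankAbove μ.cells Prod.fst Prod.snd i x := by
  rintro ⟨R, c⟩ hx ⟨hr, hb⟩
  rw [YoungDiagram.mem_cells] at hx
  dsimp only at hr
  exact hb (i, c) ((YoungDiagram.mem_cells _).2 (μ.up_left_mem (by omega) le_rfl hx)) rfl rfl

/-- The least columns are the actual columns, for the whole tableau and for any two adjacent rows,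
and in a Young diagram no cell lies below a blank. -/
theorem raisesTo_ofSemistandard (S : SemistandardYoungTableau μ) :
    RaisesTo (ofSemistandard S) (ofSemistandard S) := by
  refine RaisesTo.done ?_ ?_ ?_
  · rw [(isCellOrder_ofSemistandard S).noViolation_dual (isLeastColumning_cells S)]
    exact not_hasBlankAbove_cells
  · intro i T h
    rw [(isCellOrder_ofSemistandard S).isSwap_dual (isLeastColumning_cells S)] at h
    obtain ⟨x, hx, hb, _⟩ := h
    exact not_hasBlankAbove_cells i x hx hb
  · intro i
    refine (isCellOrder_ofSemistandard S).e_eq_none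
      (isLeastColumning_snd S (Finset.filter_subset _ _) fun R c h => ?_)
      (not_hasBlankAbove_cells i)
    rw [Finset.mem_filter, YoungDiagram.mem_cells] at h ⊢
    exact ⟨μ.up_left_mem le_rfl (Nat.le_succ c) h.1, h.2⟩

/-! ### A semistandard Young tableau with an additional cell -/

/-- When the number `y` is added to row `ρ` of `S`, it may take the position `j` in this row. -/
structure IsSlot (S : SemistandardYoungTableau μ) (y ρ j : ℕ) : Prop where
  le_rowLen : j ≤ μ.rowLen ρ
  left : ∀ c < j, S ρ c ≤ y
  right : ∀ c, j ≤ c → (ρ, c) ∈ μ → y ≤ S ρ c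

/-- The content of the additional cell `none` is `y`. -/
def slotContent (S : SemistandardYoungTableau μ) (y : ℕ) : Option (ℕ × ℕ) → ℕ
  | none => y
  | some x => S x.1 x.2

/-- The additional cell `none` is in row `ρ`. -/
def slotRow (ρ : ℕ) : Option (ℕ × ℕ) → ℕ
  | none => ρ
  | some x => x.1

/-- The additional cell `none` gets a column of its own, before column `j`. -/
def slotCol (j : ℕ) : Option (ℕ × ℕ) → ℕ
  | none => j
  | some x => if x.2 < j then x.2 else x.2 + 1

/-- The order of the cells of `S` and the additional cell. -/
def slotLT (S : SemistandardYoungTableau μ) (y ρ j : ℕ) (u v : Option (ℕ × ℕ)) : Prop :=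
  slotContent S y u ≤ slotContent S y v ∧ slotRow ρ v ≤ slotRow ρ u ∧ slotCol j u < slotCol j v

variable {S : SemistandardYoungTableau μ} {y ρ j : ℕ}

theorem some_mem_insertNone {R c : ℕ} : some (R, c) ∈ Finset.insertNone μ.cells ↔ (R, c) ∈ μ := by
  rw [Finset.some_mem_insertNone, YoungDiagram.mem_cells]

theorem IsSlot.mem_of_lt (hs : IsSlot S y ρ j) {c : ℕ} (hc : c < j) : (ρ, c) ∈ μ :=
  YoungDiagram.mem_iff_lt_rowLen.2 (hc.trans_le hs.le_rowLen)

theorem IsSlot.isCellOrder (hs : IsSlot S y ρ j) :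
    IsCellOrder ((y, ρ) ::ₘ ofSemistandard S) (Finset.insertNone μ.cells) (slotContent S y)
      (slotRow ρ) (slotLT S y ρ j) := by
  have hmap : (Finset.insertNone μ.cells).val.map (fun u => (slotContent S y u, slotRow ρ u)) =
      (y, ρ) ::ₘ ofSemistandard S := by
    simp [Finset.insertNone, ofSemistandard, slotContent, slotRow, Multiset.map_map]
  rw [← hmap]
  refine isCellOrder_of_pos (slotCol j) ?_
  rintro (_ | ⟨R, c⟩) hu (_ | ⟨R', c'⟩) hv hne h1 h2
  · exact absurd rfl hne
  · rw [some_mem_insertNone] at hv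
    simp only [slotContent, slotRow, slotCol] at h1 h2 ⊢
    split_ifs with hc
    · have hm := hs.mem_of_lt hc
      have h3 := hs.left _ hc
      rcases h2.eq_or_lt with rfl | hl
      · exact Or.inr ⟨by omega, rfl, hc⟩
      · have := S.col_strict hl hm
        omega
    · omega
  · rw [some_mem_insertNone] at hu
    simp only [slotContent, slotRow, slotCol] at h1 h2 ⊢
    split_ifs with hc
    · omega
    · have h3 := hs.right c (by omega) (μ.up_left_mem h2 le_rfl hu)
      rcases h2.eq_or_lt with rfl | hl
      · exact Or.inr ⟨by omega, rfl, by omega⟩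
      · have := S.col_strict hl hu
        omega
  · rw [some_mem_insertNone] at hu
    have := col_lt_of_le S (x := (R, c)) (y := (R', c')) hu (fun h => hne (congrArg some h)) h1 h2
    simp only [slotContent, slotRow, slotCol] at this h1 h2 ⊢
    split_ifs <;> omega

theorem slotLT_some {R c c' : ℕ} (hm : (R, c') ∈ μ) (hc : c < c') :
    slotLT S y ρ j (some (R, c)) (some (R, c')) := by
  refine ⟨S.row_weak hc hm, le_rfl, ?_⟩
  simp only [slotCol]
  split_ifs <;> omega

theorem slotLT_none {R c : ℕ} (hR : R ≤ ρ) (hc : j ≤ c) (hy : y ≤ S R c) :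
    slotLT S y ρ j none (some (R, c)) := by
  refine ⟨hy, hR, ?_⟩
  simp only [slotCol]
  split_ifs <;> omega

/-- The rows of `S`, with the additional cell, bound the columns of a form from below. -/
theorem IsSlot.lower_bounds (hs : IsSlot S y ρ j) {X : Finset (Option (ℕ × ℕ))}
    (hX : X ⊆ Finset.insertNone μ.cells) (hnone : none ∈ X)
    (hrow : ∀ R c, (R, c) ∈ μ → some (R, c) ∈ X ∨ R ≠ ρ ∧ ∀ c', some (R, c') ∉ X)
    {f : Option (ℕ × ℕ) → ℕ} (hf : IsColumning X (slotLT S y ρ j) f) :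
    (∀ c R, some (R, c) ∈ X → c ≤ f (some (R, c))) ∧ j ≤ f none ∧
      ∀ c R, some (R, c) ∈ X → R ≤ ρ → j ≤ c → y ≤ S R j → c + 1 ≤ f (some (R, c)) := by
  have hmem : ∀ R c c', some (R, c') ∈ X → c ≤ c' → some (R, c) ∈ X := by
    intro R c c' h hc
    have := some_mem_insertNone.1 (hX h)
    rcases hrow R c (μ.up_left_mem le_rfl hc this) with h' | h'
    · exact h'
    · exact absurd h (h'.2 c')
  have h1 : ∀ c R, some (R, c) ∈ X → c ≤ f (some (R, c)) := by
    intro c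
    induction c with
    | zero => intro R _; exact Nat.zero_le _
    | succ c ih =>
      intro R h
      have h' := hmem R c (c + 1) h (Nat.le_succ c)
      have := hf _ h' _ h (slotLT_some (some_mem_insertNone.1 (hX h)) (Nat.lt_succ_self c))
      have := ih R h'
      omega
  have h2 : j ≤ f none := by
    rcases Nat.eq_zero_or_pos j with hj | hj
    · omega
    · have hm : some (ρ, j - 1) ∈ X := by
        rcases hrow ρ (j - 1) (hs.mem_of_lt (by omega)) with h | h
        · exact h
        · exact absurd rfl h.1
      have := hf _ hm _ hnone ⟨hs.left _ (by omega), le_rfl, by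
        simp only [slotCol]
        split_ifs <;> omega⟩
      have := h1 _ _ hm
      omega
  -- In a row weakly above `ρ` whose entry in column `j` is at least `y`, that entry has to pass the
  -- additional cell and pushes the rest of its row one column further.
  refine ⟨h1, h2, fun c => ?_⟩
  induction c with
  | zero =>
    intro R h hR hj hy
    obtain rfl : j = 0 := by omega
    have := hf _ hnone _ h (slotLT_none hR le_rfl hy)
    omega
  | succ c ih =>
    intro R h hR hj hy
    rcases hj.eq_or_lt with rfl | hj
    · have := hf _ hnone _ h (slotLT_none hR le_rfl hy)
      omega
    · have h' := hmem R c (c + 1) h (Nat.le_succ c)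
      have := hf _ h' _ h (slotLT_some (some_mem_insertNone.1 (hX h)) (Nat.lt_succ_self c))
      have := ih R h' hR (by omega) hy
      omega

/-- Only the cells which have to be to the right of the additional cell are moved. -/
theorem IsSlot.upper_bound : IsColumning (Finset.insertNone μ.cells) (slotLT S y ρ j)
    (fun u => match u with
      | none => j
      | some x => if j ≤ x.2 ∧ y ≤ S x.1 x.2 ∧ x.1 ≤ ρ then x.2 + 1 else x.2) := by
  rintro (_ | ⟨R, c⟩) _ (_ | ⟨R', c'⟩) _ ⟨h1, h2, h3⟩ <;>
    simp only [slotContent, slotRow, slotCol] at h1 h2 h3 ⊢ <;>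
    (try split_ifs at h3 ⊢) <;> omega

/-- There is no cell directly above the additional cell when all cells are moved to the left,
and the additional cell can be moved upwards. -/
def IsMovable (S : SemistandardYoungTableau μ) (y i j : ℕ) : Prop :=
  (i, j) ∈ μ → y ≤ S i j

/-- `lower_bounds` and `upper_bound` determine `h` on all cells that matter. The strict inequality
for the other blank-above cells makes the additional cell the only one that can be swapped. -/
theorem IsSlot.hasBlankAbove_none {i : ℕ} (hs : IsSlot S y (i + 1) j) (hm : IsMovable S y i j)
    {h : Option (ℕ × ℕ) → ℕ}
    (hh : IsLeastColumning (Finset.insertNone μ.cells) (slotLT S y (i + 1) j) h) :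
    h none = j ∧ HasBlankAbove (Finset.insertNone μ.cells) (slotRow (i + 1)) h i none ∧
      ∀ i', ∀ u ∈ Finset.insertNone μ.cells,
        HasBlankAbove (Finset.insertNone μ.cells) (slotRow (i + 1)) h i' u →
          u ≠ none → j < h u := by
  have hnone : none ∈ Finset.insertNone μ.cells := Finset.none_mem_insertNone
  obtain ⟨l1, l2, l3⟩ := hs.lower_bounds subset_rfl hnone
    (fun R c hm => Or.inl (some_mem_insertNone.2 hm)) hh.1
  have hu := hh.2 _ IsSlot.upper_bound
  have hn : h none = j := le_antisymm (hu none hnone) l2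
  have hc : ∀ R c, (R, c) ∈ μ → (c < j ∨ S R c < y ∨ i + 1 < R) → h (some (R, c)) = c := by
    intro R c hRc hcase
    have h1 := l1 c R (some_mem_insertNone.2 hRc)
    have h2 := hu (some (R, c)) (some_mem_insertNone.2 hRc)
    dsimp only at h2
    rw [if_neg (by omega)] at h2
    omega
  refine ⟨hn, ⟨rfl, ?_⟩, ?_⟩
  · rintro (_ | ⟨R, c⟩) hz hr
    · simp only [slotRow] at hr
      omega
    · obtain rfl : R = i := hr
      rw [hn]
      have hz' := some_mem_insertNone.1 hz
      rcases lt_or_ge c j with hcj | hcj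
      · rw [hc R c hz' (Or.inl hcj)]
        omega
      · have := l3 c R hz (Nat.le_succ _) hcj (hm (μ.up_left_mem le_rfl hcj hz'))
        omega
  · rintro i' (_ | ⟨R, c⟩) hz ⟨hr, hb⟩ hne
    · exact absurd rfl hne
    · obtain rfl : R = i' + 1 := hr
      by_contra hlt
      have hz' := some_mem_insertNone.1 hz
      have hup : (i', c) ∈ μ := μ.up_left_mem (Nat.le_succ _) le_rfl hz'
      have h1 := l1 c _ hz
      have hstrict := S.col_strict (Nat.lt_add_one i') hz'
      have hb' := hb (some (i', c)) (some_mem_insertNone.2 hup) rfl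
      rcases lt_or_ge c j with hcj | hcj
      · exact hb' ((hc _ _ hup (Or.inl hcj)).trans (hc _ _ hz' (Or.inl hcj)).symm)
      · obtain rfl : c = j := by omega
        -- Otherwise the cell would be pushed beyond column `j`.
        have hcase : S (i' + 1) c < y ∨ i + 1 < i' + 1 := by
          by_contra hno
          have := l3 c _ hz (by omega) le_rfl (by omega)
          omega
        have hhz := hc _ _ hz' (Or.inr hcase)
        -- Directly below row `i + 1` it is the additional cell that fills the box above; in every
        -- other case the cell above is not moved either.
        by_cases hi : i' = i + 1
        · exact hb none hnone (by simp only [slotRow]; omega) (by rw [hn, hhz])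
        · exact hb' ((hc _ _ hup (Or.inr (by omega))).trans hhz.symm)

-- Movability forces both rows to shift by one from column `j` on, so cells of `S` stay below their
-- upper neighbours. Only the additional cell, alone in its column, has a blank above it; this is
-- why the raising operator picks the same cell as the swap.
open Classical in
theorem IsSlot.isLeastColumning_twoRows {i : ℕ} (hs : IsSlot S y (i + 1) j)
    (hm : IsMovable S y i j) :
    IsLeastColumning ((Finset.insertNone μ.cells).filter fun u =>
      slotRow (i + 1) u = i ∨ slotRow (i + 1) u = i + 1) (slotLT S y (i + 1) j) (slotCol j) := by
  refine ⟨fun u _ v _ h => h.2.2, fun f hf u hu => ?_⟩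
  have mem : ∀ R c, (R, c) ∈ μ → (R = i ∨ R = i + 1) →
      some (R, c) ∈ (Finset.insertNone μ.cells).filter fun u =>
        slotRow (i + 1) u = i ∨ slotRow (i + 1) u = i + 1 := fun R c h1 h2 =>
    Finset.mem_filter.2 ⟨some_mem_insertNone.2 h1, h2⟩
  obtain ⟨l1, l2, l3⟩ := hs.lower_bounds (Finset.filter_subset _ _)
    (Finset.mem_filter.2 ⟨Finset.none_mem_insertNone, Or.inr rfl⟩) (fun R c h => by
      by_cases hR : R = i ∨ R = i + 1
      · exact Or.inl (mem R c h hR)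
      · refine Or.inr ⟨fun h' => hR (Or.inr h'), fun c' hc' => hR (Finset.mem_filter.1 hc').2⟩) hf
  rcases u with _ | ⟨R, c⟩
  · exact l2
  · obtain ⟨hu', hR⟩ := Finset.mem_filter.1 hu
    rw [some_mem_insertNone] at hu'
    simp only [slotRow] at hR
    simp only [slotCol]
    split_ifs with hc
    · exact l1 c R hu
    · have hmem : (R, j) ∈ μ := μ.up_left_mem le_rfl (by omega) hu'
      refine l3 c R hu (by omega) (by omega) ?_
      rcases hR with rfl | rfl
      · exact hm hmem
      · exact hs.right j le_rfl hmem

theorem IsSlot.raisesTo_step {i : ℕ} (hs : IsSlot S y (i + 1) j) (hm : IsMovable S y i j)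
    {Q : PTab} (hQ : RaisesTo ((y, i) ::ₘ ofSemistandard S) Q) :
    RaisesTo ((y, i + 1) ::ₘ ofSemistandard S) Q := by
  obtain ⟨h, hh⟩ := hs.isCellOrder.exists_isLeastColumning
  obtain ⟨hn, hbl, hother⟩ := hs.hasBlankAbove_none hm hh
  have hnone : none ∈ Finset.insertNone μ.cells := Finset.none_mem_insertNone
  have hmin : ∀ i', ∀ u ∈ Finset.insertNone μ.cells,
      HasBlankAbove (Finset.insertNone μ.cells) (slotRow (i + 1)) h i' u → h none ≤ h u := by
    intro i' u hu hbu
    by_cases hun : u = none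
    · rw [hun]
    · exact hn.trans_le (hother i' u hu hbu hun).le
  have hdual : ((i, y) ::ₘ (PTab.dual ((y, i + 1) ::ₘ ofSemistandard S)).erase (i + 1, y)) =
      PTab.dual ((y, i) ::ₘ ofSemistandard S) := by
    simp [PTab.dual]
  refine RaisesTo.step (i := i) ?_ ?_ ?_ ?_ hQ
  · rw [hs.isCellOrder.isSwap_dual hh]
    exact ⟨none, hnone, hbl, hmin, hdual.symm⟩
  · intro i' T hT
    rw [hs.isCellOrder.isSwap_dual hh] at hT
    obtain ⟨u, hu, hbu, humin, rfl⟩ := hT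
    by_cases hun : u = none
    · subst hun
      obtain rfl : i = i' := Nat.succ.inj hbu.1
      exact ⟨rfl, hdual⟩
    · have := hother i' u hu hbu hun
      have := humin i none hnone hbl
      omega
  · rw [hs.isCellOrder.noViolation_dual hh]
    exact fun hno => hno i none hnone hbl
  · have hh2 := hs.isLeastColumning_twoRows hm
    rw [hs.isCellOrder.e_eq_some (x := none) (i := i) (h := slotCol j) (by convert hh2) hnone ?_ ?_]
    · simp [slotContent]
    · refine ⟨rfl, ?_⟩
      rintro (_ | ⟨R, c⟩) hz hr
      · simp only [slotRow] at hr
        omega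
      · simp only [slotCol]
        split_ifs <;> omega
    · rintro (_ | ⟨R, c⟩) hz hlt ⟨hr, hb⟩
      · exact lt_irrefl _ hlt
      · obtain rfl : R = i + 1 := hr
        rw [some_mem_insertNone] at hz
        exact hb (some (i, c))
          (some_mem_insertNone.2 (μ.up_left_mem (Nat.le_succ i) le_rfl hz)) rfl rfl

theorem IsSlot.up {i : ℕ} (hs : IsSlot S y (i + 1) j) (hm : IsMovable S y i j) :
    IsSlot S y i j where
  le_rowLen := hs.le_rowLen.trans (μ.rowLen_anti _ _ (Nat.le_succ i))
  left c hc := (S.col_weak (Nat.le_succ i) (hs.mem_of_lt hc)).trans (hs.left c hc)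
  right _ hc hmem := (hm (μ.up_left_mem le_rfl hc hmem)).trans (S.row_weak_of_le hc hmem)

end Semistandard

end PTab
-- Column insertion and the moves of the additional cell
namespace ColumnInsertion

open PTab

theorem intoColumn_of_forall_lt {x : ℕ} {l : List ℕ} (h : ∀ i (hi : i < l.length), l[i] < x) :
    intoColumn x l = (l ++ [x], none) := by
  induction l with
  | nil => rfl
  | cons y ys ih =>
    have h0 : y < x := h 0 (by simp)
    have := ih fun i hi => h (i + 1) (by simpa using hi)
    simp [intoColumn, h0.not_ge, this]

theorem intoColumn_of_le {x p : ℕ} {l : List ℕ} (hp : p < l.length)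
    (h : ∀ i (hi : i < p), l[i] < x) (hx : x ≤ l[p]) :
    intoColumn x l = (l.set p x, some l[p]) := by
  induction l generalizing p with
  | nil => simp at hp
  | cons y ys ih =>
    cases p with
    | zero => simp only [List.getElem_cons_zero] at hx; simp [intoColumn, hx]
    | succ p =>
      have h0 : y < x := h 0 (Nat.succ_pos p)
      have := ih (p := p) (by simpa using hp) (fun i hi => h (i + 1) (Nat.succ_lt_succ hi))
        (by simpa using hx)
      simp [intoColumn, h0.not_ge, this]

variable {μ : YoungDiagram}

/-- Column `j` of a semistandard Young tableau. -/
def column (S : SemistandardYoungTableau μ) (j : ℕ) : List ℕ :=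
  (List.range (μ.colLen j)).map fun i => S i j

theorem columns_eq (S : SemistandardYoungTableau μ) :
    columns S = (List.range (μ.rowLen 0)).map (column S) := rfl

@[simp]
theorem length_columns (S : SemistandardYoungTableau μ) : (columns S).length = μ.rowLen 0 := by
  simp [columns]

@[simp]
theorem length_column (S : SemistandardYoungTableau μ) (j : ℕ) :
    (column S j).length = μ.colLen j := by
  simp [column]

@[simp]
theorem getElem_columns (S : SemistandardYoungTableau μ) {j : ℕ} (hj : j < (columns S).length) :
    (columns S)[j] = column S j := by
  simp [columns_eq]

@[simp]
theorem getElem_column (S : SemistandardYoungTableau μ) {i j : ℕ} (hi : i < (column S j).length) :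
    (column S j)[i] = S i j := by
  simp [column]

variable {μ' : YoungDiagram} {S : SemistandardYoungTableau μ} {y ρ j : ℕ}

/-- Put `y` into the box in row `ρ` and column `j` of `S`. -/
def replace (S : SemistandardYoungTableau μ) (μ' : YoungDiagram)
    (hμ : ∀ x, x ∈ μ' ↔ x ∈ μ ∨ x = (ρ, j)) (left : ∀ c < j, S ρ c ≤ y)
    (right : ∀ c, j < c → (ρ, c) ∈ μ → y ≤ S ρ c) (above : ∀ i < ρ, S i j < y)
    (below : ∀ i, ρ < i → (i, j) ∈ μ → y < S i j) : SemistandardYoungTableau μ' where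
  entry i c := if i = ρ ∧ c = j then y else S i c
  row_weak' := by
    intro i c c' hc hm
    rcases (hμ _).1 hm with hm | hm
    · split_ifs with h1 h2 h2
      · exact le_rfl
      · obtain ⟨rfl, rfl⟩ := h1
        exact right c' hc hm
      · obtain ⟨rfl, rfl⟩ := h2
        exact left c hc
      · exact S.row_weak hc hm
    · obtain ⟨rfl, rfl⟩ := Prod.mk.inj hm
      rw [if_neg (by omega), if_pos ⟨rfl, rfl⟩]
      exact left c hc
  col_strict' := by
    intro i i' c hi hm
    rcases (hμ _).1 hm with hm | hm
    · split_ifs with h1 h2 h2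
      · omega
      · obtain ⟨rfl, rfl⟩ := h1
        exact below i' hi hm
      · obtain ⟨rfl, rfl⟩ := h2
        exact above i hi
      · exact S.col_strict hi hm
    · obtain ⟨rfl, rfl⟩ := Prod.mk.inj hm
      rw [if_neg (by omega), if_pos ⟨rfl, rfl⟩]
      exact above i hi
  zeros' := by
    intro i c hm
    rw [hμ, not_or] at hm
    rw [if_neg fun h => hm.2 (Prod.ext h.1 h.2)]
    exact S.zeros hm.1

section

variable {hμ : ∀ x, x ∈ μ' ↔ x ∈ μ ∨ x = (ρ, j)} {left : ∀ c < j, S ρ c ≤ y}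
  {right : ∀ c, j < c → (ρ, c) ∈ μ → y ≤ S ρ c} {above : ∀ i < ρ, S i j < y}
  {below : ∀ i, ρ < i → (i, j) ∈ μ → y < S i j}

theorem replace_apply (i c : ℕ) :
    replace S μ' hμ left right above below i c = if i = ρ ∧ c = j then y else S i c := rfl

theorem ofSemistandard_replace :
    ofSemistandard (replace S μ' hμ left right above below) =
      (y, ρ) ::ₘ (μ.cells.erase (ρ, j)).val.map fun x => (S x.1 x.2, x.1) := by
  have hcells : μ'.cells = Insert.insert (ρ, j) (μ.cells.erase (ρ, j)) := by
    ext x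
    rw [YoungDiagram.mem_cells, hμ, Finset.mem_insert, Finset.mem_erase, YoungDiagram.mem_cells]
    tauto
  rw [ofSemistandard, hcells, Finset.insert_val_of_notMem (Finset.notMem_erase _ _),
    Multiset.map_cons]
  refine congrArg₂ _ ?_ (Multiset.map_congr rfl fun x hx => ?_)
  · simp [replace_apply]
  · rw [replace_apply, if_neg]
    rintro ⟨h1, h2⟩
    exact Finset.ne_of_mem_erase hx (Prod.ext h1 h2)

theorem column_replace_of_ne {c : ℕ} (hc : c ≠ j) :
    column (replace S μ' hμ left right above below) c = column S c := by
  have hlen : μ'.colLen c = μ.colLen c := by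
    refine eq_of_forall_lt_iff fun i => ?_
    rw [← YoungDiagram.mem_iff_lt_colLen, ← YoungDiagram.mem_iff_lt_colLen, hμ]
    simp [hc]
  rw [column, column, hlen]
  exact List.map_congr_left fun i _ => by rw [replace_apply, if_neg (by omega)]

theorem columns_replace (hj : j < μ.rowLen 0) :
    columns (replace S μ' hμ left right above below) =
      (columns S).set j (column (replace S μ' hμ left right above below) j) := by
  have hlen : μ'.rowLen 0 = μ.rowLen 0 := by
    refine eq_of_forall_lt_iff fun c => ?_
    rw [← YoungDiagram.mem_iff_lt_rowLen, ← YoungDiagram.mem_iff_lt_rowLen, hμ, Prod.mk.injEq]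
    refine ⟨?_, Or.inl⟩
    rintro (h | ⟨_, rfl⟩)
    · exact h
    · exact YoungDiagram.mem_iff_lt_rowLen.2 hj
  refine List.ext_getElem (by simp [hlen]) fun c h1 h2 => ?_
  rw [List.getElem_set]
  split_ifs with hc
  · subst hc
    simp
  · simp [column_replace_of_ne (Ne.symm hc)]

end

theorem insert_drop_columns (hj : j < μ.rowLen 0) :
    insert y ((columns S).drop j) = match intoColumn y (column S j) with
      | (C, none) => C :: (columns S).drop (j + 1)
      | (C, some z) => C :: insert z ((columns S).drop (j + 1)) := by
  rw [List.drop_eq_getElem_cons (by simpa using hj), getElem_columns]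
  rfl

theorem take_drop_set {α : Type*} (l : List α) {n : ℕ} (hn : n < l.length) (x : α) :
    (l.set n x).take (n + 1) = l.take n ++ [x] ∧
      (l.set n x).drop (n + 1) = l.drop (n + 1) := by
  rw [List.set_eq_take_append_cons_drop, if_pos hn]
  have hlen : (l.take n ++ [x]).length = n + 1 := by simp; omega
  rw [show l.take n ++ x :: l.drop (n + 1) = (l.take n ++ [x]) ++ l.drop (n + 1) by simp]
  exact ⟨List.take_left' hlen, List.drop_left' hlen⟩

/-- Resolving `S` with an additional cell amounts to column insertion, starting from the column
of the additional cell. -/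
theorem exists_raisesTo (n : ℕ) : ∀ {μ : YoungDiagram} (S : SemistandardYoungTableau μ)
    (y ρ j : ℕ), IsSlot S y ρ j → ρ + (μ.rowLen 0 - j) = n →
    ∃ (μ' : YoungDiagram) (S' : SemistandardYoungTableau μ'),
      columns S' = (columns S).take j ++ insert y ((columns S).drop j) ∧
      RaisesTo ((y, ρ) ::ₘ ofSemistandard S) (ofSemistandard S') := by
  -- A swap lowers `ρ`, and a bump increases `j`, which is then still at most `μ.rowLen 0`.
  induction n using Nat.strong_induction_on with
  | _ n ih =>
  intro μ S y ρ j hs hn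
  by_cases hmov : ∃ i, ρ = i + 1 ∧ IsMovable S y i j
  · obtain ⟨i, rfl, hm⟩ := hmov
    obtain ⟨μ', S', hc, hr⟩ := ih (i + (μ.rowLen 0 - j)) (by omega) S y i j (hs.up hm) rfl
    exact ⟨μ', S', hc, hs.raisesTo_step hm hr⟩
  -- The additional cell is stuck, so the entry just above is smaller than `y`, and so are those
  -- above it: row `ρ` is where insertion into column `j` puts `y`.
  have hab : ∀ i < ρ, (i, j) ∈ μ ∧ S i j < y := by
    intro i hi
    obtain ⟨ρ, rfl⟩ := Nat.exists_eq_succ_of_ne_zero (Nat.ne_zero_of_lt hi)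
    have hm : ¬ IsMovable S y ρ j := fun h => hmov ⟨ρ, rfl, h⟩
    rw [IsMovable, Classical.not_imp, not_le] at hm
    have hi' : i ≤ ρ := Nat.lt_succ_iff.1 hi
    exact ⟨μ.up_left_mem hi' le_rfl hm.1, (S.col_weak hi' hm.1).trans_lt hm.2⟩
  have above : ∀ i < ρ, S i j < y := fun i hi => (hab i hi).2
  have right : ∀ c, j < c → (ρ, c) ∈ μ → y ≤ S ρ c := fun c hc => hs.right c hc.le
  have below : ∀ i, ρ < i → (i, j) ∈ μ → y < S i j := fun i hi hm =>
    (hs.right j le_rfl (μ.up_left_mem hi.le le_rfl hm)).trans_lt (S.col_strict hi hm)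
  by_cases hmem : (ρ, j) ∈ μ
  · have hμ : ∀ x, x ∈ μ ↔ x ∈ μ ∨ x = (ρ, j) := fun x =>
      ⟨Or.inl, fun h => h.elim id fun h => h ▸ hmem⟩
    have hj : j < μ.rowLen ρ := YoungDiagram.mem_iff_lt_rowLen.1 hmem
    have hj0 : j < μ.rowLen 0 := hj.trans_le (μ.rowLen_anti _ _ (Nat.zero_le ρ))
    have hρ : ρ < μ.colLen j := YoungDiagram.mem_iff_lt_colLen.1 hmem
    set S₁ := replace S μ hμ hs.left right above below with hS₁
    have hy : y ≤ S ρ j := hs.right j le_rfl hmem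
    have hs₁ : IsSlot S₁ (S ρ j) ρ (j + 1) := by
      refine ⟨hj, fun c hc => ?_, fun c hc hm => ?_⟩
      · rw [hS₁, replace_apply]
        split_ifs with h
        · exact hy
        · exact S.row_weak_of_le (Nat.lt_succ_iff.1 hc) hmem
      · rw [hS₁, replace_apply, if_neg (by omega)]
        exact S.row_weak_of_le (by omega) hm
    obtain ⟨μ', S', hc, hr⟩ := ih (ρ + (μ.rowLen 0 - (j + 1))) (by omega) S₁ _ _ _ hs₁ rfl
    refine ⟨μ', S', ?_, ?_⟩
    · have hcol : intoColumn y (column S j) = (column S₁ j, some (S ρ j)) := by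
        rw [intoColumn_of_le (p := ρ) (by simpa using hρ)
          (fun i hi => by simpa using above i hi) (by simpa using hy)]
        simp only [getElem_column, Prod.mk.injEq, and_true]
        refine List.ext_getElem (by simp) fun i h1 h2 => ?_
        rw [List.getElem_set, getElem_column, getElem_column, hS₁, replace_apply]
        simp [eq_comm]
      obtain ⟨h1, h2⟩ := take_drop_set (columns S) (by simpa using hj0) (column S₁ j)
      rw [hc, insert_drop_columns hj0, hcol, columns_replace hj0, h1, h2]
      simp
    -- Bumping only changes which cell counts as additional; the ptableau is the same.
    · have he : (y, ρ) ::ₘ ofSemistandard S = (S ρ j, ρ) ::ₘ ofSemistandard S₁ := by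
        rw [hS₁, ofSemistandard_replace, ofSemistandard,
          ← Finset.insert_erase ((YoungDiagram.mem_cells _).2 hmem),
          Finset.insert_val_of_notMem (Finset.notMem_erase _ _), Multiset.map_cons,
          Finset.erase_insert (Finset.notMem_erase _ _)]
        exact Multiset.cons_swap _ _ _
      rw [he]
      exact hr
  · have hj : j = μ.rowLen ρ := le_antisymm hs.le_rowLen
      (not_lt.1 fun h => hmem (YoungDiagram.mem_iff_lt_rowLen.2 h))
    -- The free box is a corner: everything to its left and above it is already in `μ`.
    have hlower : IsLowerSet ((Insert.insert (ρ, j) μ.cells : Finset (ℕ × ℕ)) : Set (ℕ × ℕ)) := by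
      rintro ⟨R, c⟩ ⟨R', c'⟩ ⟨hR, hc⟩ hm
      dsimp only at hR hc
      simp only [Finset.coe_insert, Set.mem_insert_iff, Finset.mem_coe, YoungDiagram.mem_cells,
        Prod.mk.injEq] at hm ⊢
      rcases hm with ⟨rfl, rfl⟩ | hm
      · rcases hR.eq_or_lt with rfl | hR
        · rcases hc.eq_or_lt with rfl | hc
          · exact Or.inl ⟨rfl, rfl⟩
          · exact Or.inr (hs.mem_of_lt hc)
        · exact Or.inr (μ.up_left_mem le_rfl hc (hab R' hR).1)
      · exact Or.inr (μ.up_left_mem hR hc hm)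
    let μ₁ : YoungDiagram := ⟨Insert.insert (ρ, j) μ.cells, hlower⟩
    have hμ : ∀ x, x ∈ μ₁ ↔ x ∈ μ ∨ x = (ρ, j) := fun x => by
      rw [← YoungDiagram.mem_cells, ← YoungDiagram.mem_cells, or_comm]
      exact Finset.mem_insert
    set S₁ := replace S μ₁ hμ hs.left right above below with hS₁
    have hcolLen : μ.colLen j = ρ := by
      refine eq_of_forall_lt_iff fun i => ?_
      rw [← YoungDiagram.mem_iff_lt_colLen]
      exact ⟨fun h => not_le.1 fun h' => hmem (μ.up_left_mem h' le_rfl h), fun h => (hab i h).1⟩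
    have hcolLen₁ : μ₁.colLen j = ρ + 1 := by
      refine eq_of_forall_lt_iff fun i => ?_
      rw [← YoungDiagram.mem_iff_lt_colLen, hμ, YoungDiagram.mem_iff_lt_colLen, hcolLen,
        Prod.mk.injEq]
      omega
    have hcolumn : column S₁ j = column S j ++ [y] := by
      rw [column, column, hcolLen₁, hcolLen, List.range_succ, List.map_append]
      refine congrArg₂ _ (List.map_congr_left fun i hi => ?_) ?_
      · rw [hS₁, replace_apply, if_neg]
        have := List.mem_range.1 hi
        omega
      · simp [hS₁, replace_apply]
    refine ⟨μ₁, S₁, ?_, ?_⟩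
    · rcases (hs.le_rowLen.trans (μ.rowLen_anti _ _ (Nat.zero_le ρ))).lt_or_eq with hj0 | hj0
      · have hcol : intoColumn y (column S j) = (column S₁ j, none) := by
          rw [hcolumn]
          refine intoColumn_of_forall_lt fun i hi => ?_
          rw [getElem_column]
          exact above i (by simpa [hcolLen] using hi)
        obtain ⟨h1, h2⟩ := take_drop_set (columns S) (by simpa using hj0) (column S₁ j)
        rw [insert_drop_columns hj0, hcol, ← List.take_append_drop (j + 1) (columns S₁),
          columns_replace hj0, h1, h2]
        simp
      -- Here `j` is past the last column, so there is no entry above to block the cell, and it has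
      -- reached the top row.
      · obtain rfl : ρ = 0 := by
          by_contra hρ
          have := YoungDiagram.mem_iff_lt_rowLen.1 (hab 0 (by omega)).1
          omega
        have hrowLen₁ : μ₁.rowLen 0 = j + 1 := by
          refine eq_of_forall_lt_iff fun i => ?_
          rw [← YoungDiagram.mem_iff_lt_rowLen, hμ, YoungDiagram.mem_iff_lt_rowLen, ← hj0,
            Prod.mk.injEq]
          omega
        have hempty : column S j = [] := by rw [column, hcolLen]; rfl
        rw [List.take_of_length_le (by simp [hj0]), List.drop_of_length_le (by simp [hj0]),
          columns_eq, hrowLen₁, List.range_succ, List.map_append, columns_eq, ← hj0]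
        refine congrArg₂ _ (List.map_congr_left fun i hi => ?_) ?_
        · have := List.mem_range.1 hi
          exact column_replace_of_ne (by omega)
        · simp [hcolumn, hempty, insert]
    · have he : ofSemistandard S₁ = (y, ρ) ::ₘ ofSemistandard S := by
        rw [hS₁, ofSemistandard_replace, Finset.erase_eq_of_notMem (by simpa using hmem)]
        rfl
      rw [← he]
      exact raisesTo_ofSemistandard S₁

end ColumnInsertion

/-! ### The word condition and semistandardness of the dual -/

namespace PTab

open ColumnInsertion

/-- The number of cells of `T` with content `i` in the rows up to `v`. -/
def countUpTo (T : PTab) (i v : ℕ) : ℕ := T.countP fun x => x.1 = i ∧ x.2 ≤ v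

theorem countUpTo_mono (T : PTab) (i : ℕ) : Monotone (T.countUpTo i) := fun v w hvw => by
  simp only [countUpTo, Multiset.countP_eq_card_filter]
  exact Multiset.card_le_card (Multiset.monotone_filter_right T fun x hx => ⟨hx.1, hx.2.trans hvw⟩)

/-- The dual of a ptableau satisfying the word condition is a semistandard Young tableau. -/
theorem WordCondition.exists_semistandard {T : PTab} (hT : T.WordCondition) :
    ∃ (μ : YoungDiagram) (P : SemistandardYoungTableau μ), ofSemistandard P = T.dual := by
  classical
  obtain ⟨N, hN⟩ : ∃ N, ∀ x ∈ T, x.1 ≤ N ∧ x.2 ≤ N := by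
    refine ⟨(T.map fun x => x.1 + x.2).sum, fun x hx => ?_⟩
    have : x.1 + x.2 ≤ (T.map fun x => x.1 + x.2).sum :=
      Multiset.single_le_sum (fun _ _ => Nat.zero_le _) _
        (Multiset.mem_map_of_mem (fun x : ℕ × ℕ => x.1 + x.2) hx)
    omega
  have hcongr : ∀ i v, N ≤ v → T.countUpTo i v = T.countUpTo i N := by
    intro i v hv
    refine Multiset.countP_congr rfl fun x hx => ?_
    have := (hN x hx).2
    simp only [eq_iff_iff]
    constructor <;> rintro ⟨h1, h2⟩ <;> exact ⟨h1, by omega⟩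
  -- This is the word condition in cumulative form; it yields both the shape (decreasing row
  -- lengths) and strict increase down the columns.
  have hstep : ∀ i v, T.countUpTo (i + 1) (v + 1) ≤ T.countUpTo i v := by
    intro i v
    rcases lt_or_ge v i with hvi | hvi
    · have h0 : T.countUpTo (i + 1) (v + 1) = 0 := by
        rw [countUpTo, Multiset.countP_eq_zero]
        rintro x hx ⟨h1, h2⟩
        have := hT.1 x hx
        omega
      omega
    · have h1 := hT.2 i (v - i)
      have h2 : T.countUpTo (i + 1) (v + 1) =
          T.countP fun x => x.1 = i + 1 ∧ i + 1 ≤ x.2 ∧ x.2 ≤ i + (v - i) + 1 := by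
        refine Multiset.countP_congr rfl fun x hx => ?_
        have := hT.1 x hx
        simp only [eq_iff_iff]
        omega
      have h3 : T.countUpTo i v = T.countP fun x => x.1 = i ∧ i ≤ x.2 ∧ x.2 ≤ i + (v - i) := by
        refine Multiset.countP_congr rfl fun x hx => ?_
        have := hT.1 x hx
        simp only [eq_iff_iff]
        omega
      omega
  have hzero : ∀ i, T.countUpTo (i + 1) 0 = 0 := by
    intro i
    rw [countUpTo, Multiset.countP_eq_zero]
    rintro x hx ⟨h1, h2⟩
    have := hT.1 x hx
    omega
  have hlen : ∀ i, T.countUpTo (i + 1) N ≤ T.countUpTo i N := fun i => by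
    rw [← hcongr (i + 1) (N + 1) (Nat.le_succ N)]
    exact hstep i N
  have hanti : Antitone fun i => T.countUpTo i N := antitone_nat_of_succ_le hlen
  have hbound : ∀ i c, c < T.countUpTo i N → i ≤ N := by
    intro i c hc
    obtain ⟨x, hx, h1, _⟩ := Multiset.countP_pos.1 (Nat.zero_lt_of_lt hc)
    have := (hN x hx).1
    omega
  let μ : YoungDiagram :=
    ⟨(Finset.range (N + 1) ×ˢ Finset.range (T.countUpTo 0 N)).filter
      fun x => x.2 < T.countUpTo x.1 N, by
      rintro ⟨R, c⟩ ⟨R', c'⟩ ⟨hR, hc⟩ hm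
      dsimp only at hR hc
      simp only [Finset.coe_filter, Finset.mem_product, Finset.mem_range, Set.mem_ofPred_eq] at hm ⊢
      have := hanti hR
      dsimp only at this
      omega⟩
  have hμ : ∀ i c, (i, c) ∈ μ ↔ c < T.countUpTo i N := by
    intro i c
    rw [← YoungDiagram.mem_cells]
    simp only [μ, Finset.mem_filter, Finset.mem_product, Finset.mem_range]
    refine ⟨And.right, fun h => ⟨⟨?_, ?_⟩, h⟩⟩
    · have := hbound i c h
      omega
    · exact h.trans_le (hanti (Nat.zero_le i))
  -- The entry in box `(i, c)` is the row of the `c`-th cell (from `0`) with content `i`, in order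
  -- of increasing rows. The value `0` outside the shape is what `zeros'` requires.
  let M : ℕ → ℕ → ℕ := fun i c => if h : ∃ v, c < T.countUpTo i v then Nat.find h else 0
  have hM : ∀ i c v, (i, c) ∈ μ → (M i c ≤ v ↔ c < T.countUpTo i v) := by
    intro i c v hm
    have hex : ∃ v, c < T.countUpTo i v := ⟨N, (hμ i c).1 hm⟩
    simp only [M, dif_pos hex]
    rw [Nat.find_le_iff]
    exact ⟨fun ⟨m, hm, h⟩ => h.trans_le (T.countUpTo_mono i hm), fun h => ⟨v, le_rfl, h⟩⟩
  have hcolstep : ∀ i c, (i + 1, c) ∈ μ → M i c < M (i + 1) c := by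
    intro i c hm
    have hm' : (i, c) ∈ μ := μ.up_left_mem (Nat.le_succ i) le_rfl hm
    have h1 := (hM (i + 1) c _ hm).1 le_rfl
    obtain hv | ⟨v, hv⟩ : M (i + 1) c = 0 ∨ ∃ v, M (i + 1) c = v + 1 := by
      cases M (i + 1) c <;> simp
    · rw [hv, hzero] at h1
      omega
    · rw [hv] at h1 ⊢
      exact Nat.lt_succ_of_le ((hM i c v hm').2 (h1.trans_le (hstep i v)))
  let P : SemistandardYoungTableau μ :=
    { entry := M
      row_weak' := fun {i c c'} hc hm =>
        (hM i c _ (μ.up_left_mem le_rfl hc.le hm)).2 (hc.trans ((hM i c' _ hm).1 le_rfl))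
      col_strict' := by
        intro i i' c hi
        induction i', hi using Nat.le_induction with
        | base => exact hcolstep i c
        | succ i' _ ih =>
          exact fun hm => (ih (μ.up_left_mem (Nat.le_succ i') le_rfl hm)).trans (hcolstep i' c hm)
      zeros' := by
        intro i c hm
        refine dif_neg ?_
        rintro ⟨v, hv⟩
        refine hm ((hμ i c).2 (hv.trans_le ?_))
        rcases le_total v N with h | h
        · exact T.countUpTo_mono i h
        · exact (hcongr i v h).le }
  refine ⟨μ, P, ?_⟩
  -- The two multisets are compared through cumulative counts; multiplicities are recovered as
  -- differences.
  have hcount : ∀ i v, ((ofSemistandard P).countP fun x => x.2 = i ∧ x.1 ≤ v) =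
      T.countUpTo i v := by
    intro i v
    rw [ofSemistandard, Multiset.countP_map, ← Finset.filter_val, ← Finset.card_def,
      ← Finset.card_range (T.countUpTo i v)]
    refine Finset.card_nbij Prod.snd ?_ ?_ ?_
    · rintro ⟨R, c⟩ hx
      obtain ⟨hm, rfl, hv⟩ := Finset.mem_filter.1 hx
      exact Finset.mem_coe.2
        (Finset.mem_range.2 ((hM _ _ _ ((YoungDiagram.mem_cells _).1 hm)).1 hv))
    · rintro ⟨R, c⟩ hx ⟨R', c'⟩ hx' h
      obtain ⟨_, rfl, _⟩ := Finset.mem_filter.1 hx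
      obtain ⟨_, h', _⟩ := Finset.mem_filter.1 hx'
      exact Prod.ext h'.symm h
    · intro c hc
      have hc' := Finset.mem_range.1 (Finset.mem_coe.1 hc)
      have hm : (i, c) ∈ μ := by
        refine (hμ i c).2 (hc'.trans_le ?_)
        rcases le_total v N with h | h
        · exact T.countUpTo_mono i h
        · exact (hcongr i v h).le
      exact ⟨(i, c), Finset.mem_coe.2 (Finset.mem_filter.2
        ⟨(YoungDiagram.mem_cells _).2 hm, rfl, (hM i c v hm).2 hc'⟩), rfl⟩
  have hdual : ∀ i v, (T.dual.countP fun x => x.2 = i ∧ x.1 ≤ v) = T.countUpTo i v := by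
    intro i v
    rw [dual, Multiset.countP_map, countUpTo, Multiset.countP_eq_card_filter]
    rfl
  have hsplit : ∀ (Q : PTab) (v i : ℕ), Q.count (v + 1, i) +
      (Q.countP fun x => x.2 = i ∧ x.1 ≤ v) = Q.countP fun x => x.2 = i ∧ x.1 ≤ v + 1 := by
    intro Q v i
    induction Q using Multiset.induction with
    | empty => simp
    | cons x Q ih =>
      rw [Multiset.count_cons, Multiset.countP_cons, Multiset.countP_cons, ← ih]
      obtain ⟨b, k⟩ := x
      simp only [Prod.mk.injEq]
      split_ifs <;> omega
  have hfirst : ∀ (Q : PTab) (i : ℕ),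
      Q.count (0, i) = Q.countP fun x => x.2 = i ∧ x.1 ≤ 0 := by
    intro Q i
    refine Multiset.countP_congr rfl fun x _ => ?_
    simp [Prod.ext_iff, eq_comm, and_comm]
  ext ⟨v, i⟩
  cases v with
  | zero => rw [hfirst, hfirst, hcount, hdual]
  | succ v =>
    have h1 := hsplit (ofSemistandard P) v i
    have h2 := hsplit T.dual v i
    rw [hcount, hcount] at h1
    rw [hdual, hdual] at h2
    omega

theorem IsExtension.le_of_mem {T : PTab} {s k : ℕ} (h : T.IsExtension s k) {x : ℕ × ℕ}
    (hx : x ∈ T) (hs : x.1 = s) : k ≤ x.2 := by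
  obtain ⟨w, ⟨rfl, _⟩, _, hw⟩ := h
  have := (List.pairwise_append.1 hw).2.2 x (Multiset.mem_coe.1 hx) (s, k) (by simp)
  dsimp only at this
  omega

end PTab

/-! ### The main theorem -/

theorem mainTheorem9 (PT : PTab) (s k : ℕ) (hPT : PT.WordCondition) (hext : PT.IsExtension s k) :
    ∃ (μ : YoungDiagram) (P : SemistandardYoungTableau μ)
      (μ' : YoungDiagram) (P' : SemistandardYoungTableau μ') (PT' : PTab),
      -- the dual of `PT` is the semistandard Young tableau `P`
      PT.dual.IsLeftJustified (ColumnInsertion.toTableau P) ∧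
      -- `PT'` is the resolution of `PT ⊗ [s]_k`
      (∀ T : PTab, PTab.IsResolution (PT.adjoin s k) T ↔ T = PT') ∧
      -- `P'` is obtained by column insertion of `k` into `P`, and is the dual of `PT'`
      ColumnInsertion.columns P' = ColumnInsertion.insert k (ColumnInsertion.columns P) ∧
      PT'.dual.IsLeftJustified (ColumnInsertion.toTableau P') ∧
      -- each swap of the resolution is, dually, the application of a raising operator
      (∀ (T T' : PTab) (i : ℕ), PTab.Swaps (PT.adjoin s k) T → PTab.IsSwap i T T' →
        PTab.e i T.dual = some T'.dual) ∧
      PT'.dual.IsHighestWeight := by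
  obtain ⟨μ, P, hP⟩ := hPT.exists_semistandard
  -- The extension condition puts every content `s` of `PT` in a row at least `k`, so row `s` of `P`
  -- has entries at least `k` and the new cell may start before column `0`.
  have hs : PTab.IsSlot P k s 0 := by
    refine ⟨Nat.zero_le _, fun c hc => absurd hc (Nat.not_lt_zero c), fun c _ hm => ?_⟩
    have hmem : (P s c, s) ∈ PT.dual := by
      rw [← hP]
      exact Multiset.mem_map.2 ⟨(s, c), (YoungDiagram.mem_cells _).2 hm, rfl⟩
    obtain ⟨x, hx, hxs⟩ := Multiset.mem_map.1 hmem
    obtain ⟨h1, h2⟩ := Prod.mk.inj hxs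
    exact (hext.le_of_mem hx h2).trans_eq h1
  obtain ⟨μ', P', hcols, hraise⟩ := ColumnInsertion.exists_raisesTo _ P k s 0 hs rfl
  have hadj : PT.adjoin s k = PTab.dual ((k, s) ::ₘ PTab.ofSemistandard P) := by
    rw [hP, PTab.dual, Multiset.map_cons, ← PTab.dual, PTab.dual_dual]
    rfl
  refine ⟨μ, P, μ', P', (PTab.ofSemistandard P').dual, ?_, ?_, ?_, ?_, ?_, ?_⟩
  · rw [← hP]
    exact PTab.isLeftJustified_toTableau P
  · rw [hadj]
    exact hraise.isResolution_iff
  · simpa using hcols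
  · rw [PTab.dual_dual]
    exact PTab.isLeftJustified_toTableau P'
  · rw [hadj]
    exact fun T T' i => hraise.e_dual
  · rw [PTab.dual_dual]
    exact hraise.isHighestWeight
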